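/- Definitions. Let $\mathcal S=\langle S,s_0,\Sigma,\to,\le,F\rangle$ be a labeled transition system with finite alphabet $\Sigma$, initial state $s_0$ and a transition relation $\xrightarrow{a}$ on $S$ for every $a\in\Sigma$, together with a well quasi order $\le$ on $S$ for which every $\xrightarrow{a}$ is monotonic (if $s_1\le s_2$ and $s_1\xrightarrow{a}s_3$, then $s_2\xrightarrow{a}s_4$ for some $s_4\ge s_3$), and a $\le$-upward-closed set $F\subseteq S$ of final states; $\mathcal S$ is then called a WSTS. Its language is $L(\mathcal S)=\{w\in\Sigma^*\mid \exists s\in F,\ s_0\xrightarrow{w}s\}$; for $F=S$ this is the trace set $T(\mathcal S)$. A subset $O$ of a directed complete partial order is *open* if it is upward closed and meets every (nonempty) directed set whose least upper bound is in $O$. $\mathcal S$ is a *complete deterministic WSTS* (cd-WSTS) if $(S,\le)$ is a continuous directed complete partial order and every $\xrightarrow{a}$ is a partial continuous function, i.e. a partial function that is monotonic, has an open domain, and preserves the least upper bounds of the directed subsets of its domain. For $u\in\Sigma^+$ the lub-acceleration $u^\omega$ is the partial function defined at those $s\in\operatorname{dom}u$ with $s\le u(s)$, by $u^\omega(s)=\operatorname{lub}\{u^n(s)\mid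 n\in\mathbb N\}$. A language $L\subseteq\Sigma^*$ is *bounded* if $L\subseteq w_1^*\cdots w_n^*$ for some $n\ge 0$ and $w_1,\dots,w_n\in\Sigma^*$; then $w_1^*\cdots w_n^*$ is called a bounded expression for $L$. An *$\infty$-effective* cd-WSTS is given to an algorithm by a finite description, relative to a coding of all states by natural numbers (a surjection $\mathbb N\to S$): the size of $\Sigma$, a code of $s_0$, codes of the elements of a finite basis of $F$ (a finite set whose upward closure is $F$), and programs that (i) decide $\le$ and the relations $s\xrightarrow{a}s'$, (ii) compute, from $s$ and $a$, a finite basis of $\uparrow\{s'\mid\exists s''\ge s,\ s'\xrightarrow{a}s''\}$, and (iii) compute $u^\omega(s)$ from $u\in\Sigma^+$ and $s\in\operatorname{dom}u^\omega$. Theorem. 1. There is an algorithm that, given a description of an $\infty$-effective cd-WSTS $\mathcal S$ whose set $F$ of final states is open (in particular, if $F=S$ and $L(\mathcal S)$ is the trace set), halts and decides whether $L(\mathcal S)$ is bounded. 2. There is an algorithm that, given a description of an $\infty$-effective cd-WSTS $\mathcal S$ (with any upward-closed $F$) whose language $L(\mathcal S)$ is bounded, halts and outputs words $w_1,\dots,w_n\in\Sigma^*$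 such that $L(\mathcal S)\subseteq w_1^*\cdots w_n^*$. -/

import Mathlib

open Nat.Partrec (Code)

universe u v

/-! Orders: directed complete partial orders, continuity, bases of upward-closed sets -/

/-- Every nonempty directed subset has a least upper bound. -/
def IsDcpo (S : Type u) [PartialOrder S] : Prop :=
  ∀ D : Set S, D.Nonempty → DirectedOn (· ≤ ·) D → ∃ x, IsLUB D x

/-- The way-below relation. -/
def WayBelow {S : Type u} [PartialOrder S] (s t : S) : Prop :=
  ∀ D : Set S, D.Nonempty → DirectedOn (· ≤ ·) D →
    ∀ x, IsLUB D x → t ≤ x → ∃ d ∈ D, s ≤ d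

/-- A dcpo in which the elements way below any `t` form a directed set with least upper
bound `t`. -/
def IsContinuousDcpo (S : Type u) [PartialOrder S] : Prop :=
  IsDcpo S ∧ ∀ t : S, {s : S | WayBelow s t}.Nonempty ∧
    DirectedOn (· ≤ ·) {s : S | WayBelow s t} ∧ IsLUB {s : S | WayBelow s t} t

/-- Scott-open sets: upward closed, and every directed set whose least upper bound lies in
the set meets the set. -/
def IsOrderOpen {S : Type u} [PartialOrder S] (O : Set S) : Prop :=
  IsUpperSet O ∧ DirSupInacc O

/-- The domain of a relation. -/
def relDom {S : Type u} (R : S → S → Prop) : Set S := {s | ∃ t, R s t}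

/-- The relation `R` is (the graph of) a partial function. -/
def IsPartialFunction {S : Type u} (R : S → S → Prop) : Prop :=
  ∀ s t t', R s t → R s t' → t = t'

/-- Monotonicity of a relation with respect to an order. -/
def IsMonotonicRel {S : Type u} [Preorder S] (R : S → S → Prop) : Prop :=
  ∀ s₁ s₂ s₃, s₁ ≤ s₂ → R s₁ s₃ → ∃ s₄, s₃ ≤ s₄ ∧ R s₂ s₄

/-- Partial continuous functions, given by their graphs: monotonic, with open domain, and
preserving the least upper bounds of the directed subsets of the domain. -/
structure IsPartialContinuous {S : Type u} [PartialOrder S] (R : S → S → Prop) : Prop where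
  functional : IsPartialFunction R
  monotonic : IsMonotonicRel R
  dom_open : IsOrderOpen (relDom R)
  map_lub : ∀ D : Set S, D.Nonempty → DirectedOn (· ≤ ·) D → D ⊆ relDom R →
    ∀ x y, IsLUB D x → R x y → IsLUB {t | ∃ s ∈ D, R s t} y

/-! Labeled and well-structured transition systems -/

/-- Labeled transition systems with set of states `S` and set of labels `A`. -/
structure LTS (S : Type u) (A : Type v) where
  init : S
  step : A → S → S → Prop

/-- The transition relations extended to words. -/
def LTS.run {S : Type u} {A : Type v} (T : LTS S A) : List A → S → S → Prop
  | [], s, t => s = t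
  | a :: w, s, t => ∃ s', T.step a s s' ∧ LTS.run T w s' t

def LTS.Deterministic {S : Type u} {A : Type v} (T : LTS S A) : Prop :=
  ∀ a, IsPartialFunction (T.step a)

/-- The graph of the lub-acceleration of the word `w`: it is defined at `s` if `w` can be
fired from `s` and leads to some `s' ≥ s`, and its value is then the least upper bound of the
states reached from `s` by the powers of `w`. -/
def LTS.lubAccel {S : Type u} {A : Type v} [Preorder S] (T : LTS S A) (w : List A)
    (s t : S) : Prop :=
  (∃ s', T.run w s s' ∧ s ≤ s') ∧
    IsLUB {x | ∃ n : ℕ, T.run (List.replicate n w).flatten s x} t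

/-- Well-structured transition systems with an upward-closed set of final states. -/
structure WSTS (S : Type u) (A : Type v) [Preorder S] extends LTS S A where
  final : Set S
  wqo : WellQuasiOrdered (fun s t : S => s ≤ t)
  final_upper : IsUpperSet final
  monotonic : ∀ a, IsMonotonicRel (step a)

/-- The language of a WSTS. -/
def WSTS.language {S : Type u} {A : Type v} [Preorder S] (W : WSTS S A) : Language A :=
  {w | ∃ s ∈ W.final, W.run w W.init s}

/-- The upward closure of the set of states that have an `a`-successor above `s`. -/
def WSTS.upPred {S : Type u} {A : Type v} [Preorder S] (W : WSTS S A) (a : A) (s : S) :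
    Set S :=
  {t | ∃ s', s' ≤ t ∧ ∃ s'', W.step a s' s'' ∧ s ≤ s''}

/-- Complete deterministic WSTS. -/
structure WSTS.IsCompleteDeterministic {S : Type u} {A : Type v} [PartialOrder S]
    (W : WSTS S A) : Prop where
  deterministic : W.Deterministic
  continuous_dcpo : IsContinuousDcpo S
  continuous_step : ∀ a, IsPartialContinuous (W.step a)

/-! Bounded languages -/

/-- The language of the bounded expression `w₁* ⋯ wₙ*`. -/
def boundedExpr {A : Type v} (ws : List (List A)) : Language A :=
  (ws.map fun w => KStar.kstar ({w} : Language A)).prod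

/-- Bounded languages. -/
def IsBoundedLanguage {A : Type v} (L : Language A) : Prop :=
  ∃ ws : List (List A), L ≤ boundedExpr ws

/-! Effective presentations -/

/-- The program `c`, run on (the code of) `x`, halts with result (the code of) `y`. -/
def Computes {X Y : Type} [Encodable X] [Encodable Y] (c : Code) (x : X) (y : Y) : Prop :=
  Encodable.encode y ∈ c.eval (Encodable.encode x)

/-- The finite data handed to an algorithm that takes a WSTS as its input: the number of
labels, a code of the initial state, codes of a basis of the set of final states, and programs
for the order, the transition relations, the predecessor bases and the lub-accelerations. -/
structure Description where
  labels : ℕ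
  init : ℕ
  final : List ℕ
  le : Code
  step : Code
  pred : Code
  accel : Code

/-- Descriptions as tuples. -/
def Description.equivProd :
    Description ≃ ℕ × ℕ × List ℕ × Code × Code × Code × Code where
  toFun d := (d.labels, d.init, d.final, d.le, d.step, d.pred, d.accel)
  invFun p := ⟨p.1, p.2.1, p.2.2.1, p.2.2.2.1, p.2.2.2.2.1, p.2.2.2.2.2.1, p.2.2.2.2.2.2⟩
  left_inv _ := rfl
  right_inv _ := rfl

instance : Primcodable Description :=
  Primcodable.ofEquiv _ Description.equivProd

/-- The finite list `B` of codes is a basis of the upward-closed set `C`. -/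
def IsCodedBasis {S : Type u} [Preorder S] (ν : ℕ → S) (B : List ℕ) (C : Set S) : Prop :=
  ∀ s, s ∈ C ↔ ∃ m ∈ B, ν m ≤ s

/-- `d` describes the WSTS `W` when the states are coded by natural numbers through the
surjection `ν`. The order and the transition relations are decidable, and finite bases of the
sets `upPred` are computable: `W` is `Pred`-effective. Moreover the lub-accelerations of
nonempty words are computable: `W` is `∞`-effective. Nothing is asked of the program for
lub-accelerations outside their domains. -/
structure Describes (d : Description) {S : Type u} [Preorder S] (ν : ℕ → S)
    (W : WSTS S (Fin d.labels)) : Prop where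
  surj : Function.Surjective ν
  init : ν d.init = W.init
  final : IsCodedBasis ν d.final W.final
  le : ∀ m n : ℕ, ∃ b : Bool, Computes d.le (m, n) b ∧ (b = true ↔ ν m ≤ ν n)
  step : ∀ (a : Fin d.labels) (m n : ℕ),
    ∃ b : Bool, Computes d.step ((a : ℕ), m, n) b ∧ (b = true ↔ W.step a (ν m) (ν n))
  pred : ∀ (a : Fin d.labels) (m : ℕ),
    ∃ B : List ℕ, Computes d.pred ((a : ℕ), m) B ∧ IsCodedBasis ν B (W.upPred a (ν m))
  accel : ∀ w : List (Fin d.labels), w ≠ [] → ∀ (m : ℕ) (t : S), W.lubAccel w (ν m) t →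
    ∃ n : ℕ, Computes d.accel (List.map Fin.val w, m) n ∧ ν n = t

/-! Both answers have witnesses that can be enumerated. Boundedness is witnessed by an expression
`ws` and a finite proof that the language lies in `boundedExpr ws`. Unboundedness is witnessed by an
increasing fork. A parallel search for either decides boundedness, and the first search alone yields
the expression once boundedness is promised, whether or not the final set is open.

A fork at `s` has a run starting with `a` and a run starting with `b ≠ a`, the latter possibly
accelerated, both leading above `s`. If the final set is open, a lub-acceleration can be replaced by
a finite power whenever a given word has to be accepted afterwards. So the language of `s`, which is
nonempty, is closed under prepending one fixed word that starts with `a` and, for each of its words,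
some word that starts with `b`. Its words can be completed on the left to words of the whole
language. A periodicity argument (`not_isPrefix_replicate_of_ne`, `not_forall_suffix_boundedExpr`)
rules out every bounded expression.

Conversely, a state with unbounded language has a successor with unbounded language. Well quasi
ordering finds an increase along an infinite run of such states, and acceleration turns it into an
exact loop `u` on a state `t` whose language is still unbounded. If every exit from the loop led to
a bounded language, the language of `t` would be bounded by `u*` followed by finitely many bounded
pieces. So some exit is unbounded (`exists_branch_not_isBoundedLanguage`), and the construction
repeats from there. Two comparable loop states in the resulting sequence give the fork.

Inclusion in `boundedExpr ws` is proved by backward coverability in the product with a finite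
automaton for the expression. The certificate lists finite bases of sets containing all states that
accept a word rejected by the automaton, and the initial state lies in none of those attached to the
initial automaton state. Such bases exist by well quasi ordering; they need not be computed, only
found and checked. -/

/-! ### Semidecidable predicates and unbounded search -/

/-- The predicates that are projections of primitive recursive ones. -/
def SemiDecidable {α : Type*} [Primcodable α] (p : α → Prop) : Prop :=
  ∃ R : α × ℕ → Prop, PrimrecPred R ∧ ∀ a, p a ↔ ∃ n, R (a, n)

namespace SemiDecidable

variable {α β γ : Type*} [Primcodable α] [Primcodable β] [Primcodable γ]

theorem of_primrecPred {p : α → Prop} (hp : PrimrecPred p) : SemiDecidable p :=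
  ⟨fun x => p x.1, hp.comp Primrec.fst, fun a => by simp⟩

theorem of_eq {p q : α → Prop} (hp : SemiDecidable p) (h : ∀ a, p a ↔ q a) :
    SemiDecidable q := by
  obtain ⟨R, hR, hp⟩ := hp
  exact ⟨R, hR, fun a => (h a).symm.trans (hp a)⟩

theorem comp {p : β → Prop} {f : α → β} (hp : SemiDecidable p) (hf : Primrec f) :
    SemiDecidable fun a => p (f a) := by
  obtain ⟨R, hR, hp⟩ := hp
  exact ⟨fun x => R (f x.1, x.2), hR.comp ((hf.comp Primrec.fst).pair Primrec.snd),
    fun a => hp (f a)⟩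

theorem and {p q : α → Prop} (hp : SemiDecidable p) (hq : SemiDecidable q) :
    SemiDecidable fun a => p a ∧ q a := by
  obtain ⟨R, hR, hp⟩ := hp
  obtain ⟨R', hR', hq⟩ := hq
  refine ⟨fun x => R (x.1, x.2.unpair.1) ∧ R' (x.1, x.2.unpair.2),
    (hR.comp (Primrec.fst.pair (Primrec.fst.comp (Primrec.unpair.comp Primrec.snd)))).and
      (hR'.comp (Primrec.fst.pair (Primrec.snd.comp (Primrec.unpair.comp Primrec.snd)))),
    fun a => ?_⟩
  simp only [hp, hq]
  constructor
  · rintro ⟨⟨m, hm⟩, n, hn⟩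
    exact ⟨Nat.pair m n, by simpa using ⟨hm, hn⟩⟩
  · rintro ⟨k, hk⟩
    exact ⟨⟨_, hk.1⟩, _, hk.2⟩

theorem or {p q : α → Prop} (hp : SemiDecidable p) (hq : SemiDecidable q) :
    SemiDecidable fun a => p a ∨ q a := by
  obtain ⟨R, hR, hp⟩ := hp
  obtain ⟨R', hR', hq⟩ := hq
  refine ⟨fun x => R x ∨ R' x, hR.or hR', fun a => ?_⟩
  simp only [hp, hq, exists_or]

/-- One number codes both the candidate `b` and the stage at which `R` confirms it. Numbers that
decode to no element of `β` yield `none`. -/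
theorem ex {p : α × β → Prop} (hp : SemiDecidable p) :
    SemiDecidable fun a => ∃ b, p (a, b) := by
  classical
  obtain ⟨R, hR, hp⟩ := hp
  have hR' : Primrec₂ fun (x : α × ℕ) (b : β) =>
      if R ((x.1, b), x.2.unpair.2) then some () else none := by
    refine Primrec.ite (hR.comp ?_) (Primrec.const _) (Primrec.const _)
    exact ((Primrec.fst.comp Primrec.fst).pair Primrec.snd).pair
      (Primrec.snd.comp (Primrec.unpair.comp (Primrec.snd.comp Primrec.fst)))
  have hd : Primrec fun x : α × ℕ => (Encodable.decode x.2.unpair.1 : Option β) :=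
    Primrec.decode.comp (Primrec.fst.comp (Primrec.unpair.comp Primrec.snd))
  refine ⟨fun x => ((Encodable.decode x.2.unpair.1 : Option β).bind fun b =>
    if R ((x.1, b), x.2.unpair.2) then some () else none) = some (),
    Primrec.eq.comp (Primrec.option_bind hd hR') (Primrec.const _), fun a => ?_⟩
  constructor
  · rintro ⟨b, hb⟩
    obtain ⟨n, hn⟩ := (hp _).1 hb
    exact ⟨Nat.pair (Encodable.encode b) n, by simp [hn]⟩
  · rintro ⟨k, hk⟩
    obtain ⟨b, -, hb⟩ := Option.bind_eq_some_iff.1 hk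
    refine ⟨b, (hp _).2 ⟨k.unpair.2, ?_⟩⟩
    by_contra h
    simp [h] at hb

theorem exists_mem {p : α × β → Prop} {l : α → List β} (hp : SemiDecidable p)
    (hl : Primrec l) : SemiDecidable fun a => ∃ b ∈ l a, p (a, b) := by
  classical
  obtain ⟨R, hR, hp⟩ := hp
  have h : PrimrecRel fun (b : β) (x : α × ℕ) => R ((x.1, b), x.2) :=
    hR.comp (((Primrec.fst.comp Primrec.snd).pair Primrec.fst).pair
      (Primrec.snd.comp Primrec.snd))
  refine ⟨fun x => ∃ b ∈ l x.1, R ((x.1, b), x.2),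
    h.exists_mem_list.comp (hl.comp Primrec.fst) Primrec.id, fun a => ?_⟩
  simp only [hp]
  constructor
  · rintro ⟨b, hb, n, hn⟩
    exact ⟨n, b, hb, hn⟩
  · rintro ⟨n, b, hb, hn⟩
    exact ⟨b, hb, n, hn⟩

/-- A finite list has a common bound on the stages of its elements, and the quantifiers over the
list and below the bound are primitive recursive. -/
theorem forall_mem {p : α × β → Prop} {l : α → List β} (hp : SemiDecidable p)
    (hl : Primrec l) : SemiDecidable fun a => ∀ b ∈ l a, p (a, b) := by
  classical
  obtain ⟨R, hR, hp⟩ := hp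
  have h : PrimrecRel fun (n : ℕ) (x : α × β) => R (x, n) :=
    hR.comp (Primrec.snd.pair Primrec.fst)
  have h' : PrimrecRel fun (b : β) (x : α × ℕ) => ∃ n ∈ List.range x.2, R ((x.1, b), n) :=
    PrimrecPred.primrecRel
      (p := fun y : β × α × ℕ => ∃ n ∈ List.range y.2.2, R ((y.2.1, y.1), n))
      (PrimrecRel.comp (R := fun (L : List ℕ) (z : α × β) => ∃ n ∈ L, R (z, n)) h.exists_mem_list
        (Primrec.list_range.comp (Primrec.snd.comp Primrec.snd))
        ((Primrec.fst.comp Primrec.snd).pair Primrec.fst))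
  refine ⟨fun x => ∀ b ∈ l x.1, ∃ n ∈ List.range x.2, R ((x.1, b), n),
    h'.forall_mem_list.comp (hl.comp Primrec.fst) Primrec.id, fun a => ?_⟩
  simp only [hp, List.mem_range]
  constructor
  · intro H
    generalize l a = l at H
    induction l with
    | nil => exact ⟨0, by simp⟩
    | cons b l ih =>
      obtain ⟨N, hN⟩ := ih fun b hb => H b (List.mem_cons_of_mem _ hb)
      obtain ⟨n, hn⟩ := H b List.mem_cons_self
      refine ⟨max N (n + 1), fun c hc => ?_⟩
      rcases List.mem_cons.1 hc with rfl | hc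
      · exact ⟨n, by omega, hn⟩
      · obtain ⟨k, hk, h⟩ := hN c hc
        exact ⟨k, by omega, h⟩
  · rintro ⟨N, hN⟩ b hb
    obtain ⟨n, -, hn⟩ := hN b hb
    exact ⟨n, hn⟩

/-- A path is coded as a list of edges. The fold checks that consecutive edges fit together; `none`
records a mismatch and is absorbing. -/
theorem reflTransGen_iff_exists_list {β : Type*} [DecidableEq β] (r : β → β → Prop) (x y : β) :
    Relation.ReflTransGen r x y ↔ ∃ l : List (β × β),
      (∀ e ∈ l, r e.1 e.2) ∧
        l.foldl (fun o e => if o = some e.1 then some e.2 else none) (some x) = some y := by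
  constructor
  · intro h
    induction h with
    | refl => exact ⟨[], by simp⟩
    | @tail y z _ hyz ih =>
      obtain ⟨l, hl, hy⟩ := ih
      refine ⟨l ++ [(y, z)], ?_, by simp [hy]⟩
      intro e he
      rcases List.mem_append.1 he with he | he
      · exact hl e he
      · rw [List.mem_singleton.1 he]
        exact hyz
  · rintro ⟨l, hl, hy⟩
    induction l using List.reverseRecOn generalizing y with
    | nil =>
      obtain rfl : x = y := by simpa using hy
      exact .refl
    | append_singleton l e ih =>
      rw [List.foldl_append, List.foldl_cons, List.foldl_nil] at hy
      split_ifs at hy with h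
      obtain rfl : e.2 = y := by simpa using hy
      exact (ih _ (fun e he => hl e (by simp [he])) h).tail (hl e (by simp))

theorem reflTransGen {r : α → β → β → Prop}
    (hr : SemiDecidable fun z : α × β × β => r z.1 z.2.1 z.2.2) :
    SemiDecidable fun z : α × β × β => Relation.ReflTransGen (r z.1) z.2.1 z.2.2 := by
  classical
  have h1 : SemiDecidable fun z : (α × β × β) × List (β × β) => ∀ e ∈ z.2, r z.1.1 e.1 e.2 :=
    forall_mem (p := fun w : ((α × β × β) × List (β × β)) × (β × β) => r w.1.1.1 w.2.1 w.2.2)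
      (hr.comp ((Primrec.fst.comp (Primrec.fst.comp Primrec.fst)).pair Primrec.snd))
      Primrec.snd
  have h2 : Primrec fun z : (α × β × β) × List (β × β) =>
      z.2.foldl (fun o e => if o = some e.1 then some e.2 else none) (some z.1.2.1) := by
    refine Primrec.list_foldl (h := fun _ (oe : Option β × (β × β)) => if oe.1 = some oe.2.1 then some oe.2.2 else none)
      Primrec.snd (Primrec.option_some.comp
      (Primrec.fst.comp (Primrec.snd.comp Primrec.fst))) ?_
    refine Primrec.ite (Primrec.eq.comp (Primrec.fst.comp Primrec.snd) (Primrec.option_some.comp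
      (Primrec.fst.comp (Primrec.snd.comp Primrec.snd)))) ?_ (Primrec.const _)
    exact Primrec.option_some.comp (Primrec.snd.comp (Primrec.snd.comp Primrec.snd))
  have h3 := (h1.and (of_primrecPred (Primrec.eq.comp h2 (Primrec.option_some.comp
    (Primrec.snd.comp (Primrec.snd.comp Primrec.fst)))))).ex
  exact h3.of_eq fun z => (reflTransGen_iff_exists_list (r z.1) z.2.1 z.2.2).symm

/-- Results of programs can be enumerated. -/
theorem computes {X Y : Type} [Primcodable X] [Primcodable Y] {c : α → Code} {x : α → X}
    {y : α → Y} (hc : Primrec c) (hx : Primrec x) (hy : Primrec y) :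
    SemiDecidable fun a => Computes (c a) (x a) (y a) := by
  refine ⟨fun z => Code.evaln z.2 (c z.1) (Encodable.encode (x z.1)) =
    some (Encodable.encode (y z.1)), ?_, fun a => Nat.Partrec.Code.evaln_complete⟩
  refine Primrec.eq.comp (Nat.Partrec.Code.primrec_evaln.comp
    ((Primrec.snd.pair (hc.comp Primrec.fst)).pair (Primrec.encode.comp (hx.comp Primrec.fst))))
    (Primrec.option_some.comp (Primrec.encode.comp (hy.comp Primrec.fst)))

/-- Unbounded search for a witness. -/
theorem exists_partrec {p : α × β → Prop} (hp : SemiDecidable p) :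
    ∃ f : α →. β, Partrec f ∧ (∀ a, ∀ b ∈ f a, p (a, b)) ∧ ∀ a b, p (a, b) → (f a).Dom := by
  classical
  obtain ⟨R, hR, hp⟩ := hp
  let g : α → ℕ → Option β := fun a n => (Encodable.decode n.unpair.1 : Option β).bind fun b =>
    if R ((a, b), n.unpair.2) then some b else none
  have hg : Primrec₂ g := by
    refine Primrec.option_bind (Primrec.decode.comp
      (Primrec.fst.comp (Primrec.unpair.comp Primrec.snd))) ?_
    refine Primrec.ite (hR.comp ?_) (Primrec.option_some.comp Primrec.snd) (Primrec.const _)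
    exact ((Primrec.fst.comp Primrec.fst).pair Primrec.snd).pair
      (Primrec.snd.comp (Primrec.unpair.comp (Primrec.snd.comp Primrec.fst)))
  refine ⟨fun a => Nat.rfindOpt (g a), Partrec.rfindOpt hg.to_comp, fun a b hb => ?_,
    fun a b hb => ?_⟩
  · obtain ⟨n, hn⟩ := Nat.rfindOpt_spec hb
    obtain ⟨b', -, hb'⟩ := Option.bind_eq_some_iff.1 hn
    split_ifs at hb' with h
    obtain rfl : b' = b := by simpa using hb'
    exact (hp _).2 ⟨_, h⟩
  · obtain ⟨n, hn⟩ := (hp _).1 hb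
    exact Nat.rfindOpt_dom.2 ⟨Nat.pair (Encodable.encode b) n, b, by simp [g, hn]⟩

end SemiDecidable

/-! Bounded expressions -/

section BoundedExpr

variable {A : Type v}

theorem boundedExpr_cons (w : List A) (ws : List (List A)) :
    boundedExpr (w :: ws) = KStar.kstar ({w} : Language A) * boundedExpr ws := by
  simp [boundedExpr]

theorem mem_boundedExpr_nil {z : List A} : z ∈ boundedExpr ([] : List (List A)) ↔ z = [] := by
  simp [boundedExpr, Language.mem_one]

theorem mem_boundedExpr_cons {w : List A} {ws : List (List A)} {z : List A} :
    z ∈ boundedExpr (w :: ws) ↔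
      ∃ k r, r ∈ boundedExpr ws ∧ z = (List.replicate k w).flatten ++ r := by
  rw [boundedExpr_cons, Language.mem_mul]
  constructor
  · rintro ⟨y, hy, r, hr, rfl⟩
    obtain ⟨L, rfl, hL⟩ := Language.mem_kstar.1 hy
    refine ⟨L.length, r, hr, ?_⟩
    rw [← List.eq_replicate_of_mem (a := w) (l := L) fun b hb => hL b hb]
  · rintro ⟨k, r, hr, rfl⟩
    refine ⟨_, Language.join_mem_kstar fun y hy => ?_, r, hr, rfl⟩
    exact List.eq_of_mem_replicate hy

theorem nil_mem_boundedExpr (ws : List (List A)) : [] ∈ boundedExpr ws := by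
  induction ws with
  | nil => exact mem_boundedExpr_nil.2 rfl
  | cons w ws ih => exact mem_boundedExpr_cons.2 ⟨0, [], ih, by simp⟩

theorem append_mem_boundedExpr {ws ws' : List (List A)} {z z' : List A}
    (h : z ∈ boundedExpr ws) (h' : z' ∈ boundedExpr ws') :
    z ++ z' ∈ boundedExpr (ws ++ ws') := by
  have : boundedExpr (ws ++ ws') = boundedExpr ws * boundedExpr ws' := by simp [boundedExpr]
  rw [this]
  exact Language.append_mem_mul h h'

theorem boundedExpr_le_append_left (ws ws' : List (List A)) :
    boundedExpr ws ≤ boundedExpr (ws ++ ws') := fun z hz =>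
  List.append_nil z ▸ append_mem_boundedExpr hz (nil_mem_boundedExpr ws')

theorem boundedExpr_le_append_right (ws ws' : List (List A)) :
    boundedExpr ws' ≤ boundedExpr (ws ++ ws') := fun _ hz =>
  append_mem_boundedExpr (nil_mem_boundedExpr ws) hz

theorem replicate_mem_boundedExpr (w : List A) (k : ℕ) :
    (List.replicate k w).flatten ∈ boundedExpr [w] :=
  mem_boundedExpr_cons.2 ⟨k, [], nil_mem_boundedExpr _, by simp⟩

theorem self_mem_boundedExpr (w : List A) : w ∈ boundedExpr [w] := by
  simpa using replicate_mem_boundedExpr w 1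

/-- Used to pass between words over `Fin d.labels` and the words over `ℕ` that programs handle. -/
theorem map_mem_boundedExpr {B : Type*} {f : A → B} (hf : Function.Injective f)
    {ws : List (List A)} {z : List A} :
    z.map f ∈ boundedExpr (ws.map (List.map f)) ↔ z ∈ boundedExpr ws := by
  induction ws generalizing z with
  | nil => simp [mem_boundedExpr_nil]
  | cons w ws ih =>
    simp only [List.map_cons, mem_boundedExpr_cons]
    constructor
    · rintro ⟨k, r, hr, h⟩
      obtain ⟨z₁, z₂, rfl, h₁, rfl⟩ := List.map_eq_append_iff.1 h
      refine ⟨k, z₂, ih.1 hr, ?_⟩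
      rw [← List.map_replicate, ← List.map_flatten] at h₁
      rw [List.map_injective_iff.2 hf h₁]
    · rintro ⟨k, r, hr, rfl⟩
      exact ⟨k, r.map f, ih.2 hr, by simp [List.map_flatten]⟩

/-- A finite union of bounded languages is bounded. -/
theorem IsBoundedLanguage.iUnion {ι : Type*} [Finite ι] {L : ι → Language A}
    (h : ∀ i, IsBoundedLanguage (L i)) : ∃ ws, ∀ i, L i ≤ boundedExpr ws := by
  have := Fintype.ofFinite ι
  suffices ∀ l : List ι, ∃ ws, ∀ i ∈ l, L i ≤ boundedExpr ws by
    obtain ⟨ws, hws⟩ := this (Finset.univ : Finset ι).toList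
    exact ⟨ws, fun i => hws i (by simp)⟩
  intro l
  induction l with
  | nil => exact ⟨[], by simp⟩
  | cons i l ih =>
    obtain ⟨ws, hws⟩ := ih
    obtain ⟨ws', hws'⟩ := h i
    refine ⟨ws' ++ ws, fun j hj => ?_⟩
    rcases List.mem_cons.1 hj with rfl | hj
    · exact hws'.trans (boundedExpr_le_append_left _ _)
    · exact (hws j hj).trans (boundedExpr_le_append_right _ _)

/-- A prefix of a power of `w` has period `w.length`: removing one copy of `w` at the front or at
the back of a power leaves the same word. -/
theorem getElem?_add_length_of_isPrefix {w z : List A} {e : ℕ}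
    (hz : z <+: (List.replicate e w).flatten) {i : ℕ} (hi : i + w.length < z.length) :
    z[i + w.length]? = z[i]? := by
  obtain ⟨y, hy⟩ := hz
  have hz : ∀ {j}, j < z.length → z[j]? = ((List.replicate e w).flatten)[j]? := fun hj => by
    rw [← List.getElem?_append_left (l₂ := y) hj, hy]
  rw [hz hi, hz (by omega)]
  have hlen : i + w.length < ((List.replicate e w).flatten).length := by
    rw [← hy, List.length_append]; omega
  cases e with
  | zero => simp at hlen
  | succ e =>
    have h₁ : (List.replicate (e + 1) w).flatten = w ++ (List.replicate e w).flatten := by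
      simp [List.replicate_succ]
    have h₂ : (List.replicate (e + 1) w).flatten = (List.replicate e w).flatten ++ w := by
      simp [List.replicate_succ']
    conv_lhs => rw [h₁]
    conv_rhs => rw [h₂]
    rw [List.getElem?_append_right (by omega), Nat.add_sub_cancel,
      List.getElem?_append_left]
    rw [h₁, List.length_append] at hlen
    omega

theorem getElem?_add_mul_length_of_isPrefix {w z : List A} {e : ℕ}
    (hz : z <+: (List.replicate e w).flatten) {i : ℕ} (k : ℕ)
    (hi : i + k * w.length < z.length) : z[i + k * w.length]? = z[i]? := by
  induction k with
  | zero => simp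
  | succ k ih =>
    rw [Nat.succ_mul, ← Nat.add_assoc] at hi ⊢
    rw [getElem?_add_length_of_isPrefix hz hi, ih (by omega)]

/-- A word `y ++ xᵖ ++ [b]`, where `b` is not the first letter of `x`, is not a prefix of a
power of a word of length at most `p`. -/
theorem not_isPrefix_replicate_of_ne {a b : A} (hab : a ≠ b) (x y w : List A) (e : ℕ) :
    ¬ (y ++ ((List.replicate w.length (a :: x)).flatten ++ [b]) <+:
      (List.replicate e w).flatten) := by
  intro h
  have hlen : (y ++ ((List.replicate w.length (a :: x)).flatten ++ [b])).length =
      y.length + (a :: x).length * w.length + 1 := by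
    simp [Nat.mul_comm, Nat.add_assoc]
  have hlen' : ((List.replicate w.length (a :: x)).flatten).length =
      (a :: x).length * w.length := by
    simp [Nat.mul_comm]
  -- The word would have period `w.length`, hence also the multiple `(a :: x).length * w.length`,
  -- which is the distance from the first `a` after `y` to the final `b`.
  have := getElem?_add_mul_length_of_isPrefix h (i := y.length) (a :: x).length
    (by rw [hlen]; omega)
  rw [List.getElem?_append_right (by omega), List.getElem?_append_right (by omega),
    List.getElem?_append_right (by omega), hlen'] at this
  rcases w with _ | ⟨c, w⟩
  · have := h.length_le
    simp at this
  · rw [List.getElem?_append_left (by simp)] at this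
    simp [List.replicate_succ] at this
    exact hab this.symm

/-- A nonempty language that is closed under prepending `x` and under prepending some word
starting with `b`, where `b` is not the first letter of `x`, does not consist of suffixes of
the words of a bounded language. -/
theorem not_forall_suffix_boundedExpr {K : Set (List A)} (hK : K.Nonempty) {a b : A}
    (hab : a ≠ b) {x : List A} (hx : ∀ z ∈ K, a :: x ++ z ∈ K)
    (hb : ∀ z ∈ K, ∃ y, b :: y ++ z ∈ K) (ws : List (List A)) :
    ¬ ∀ z ∈ K, ∃ y, y ++ z ∈ boundedExpr ws := by
  have hpow : ∀ p, ∀ z ∈ K, (List.replicate p (a :: x)).flatten ++ z ∈ K := by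
    intro p
    induction p with
    | zero => simp
    | succ p ih =>
      intro z hz
      have := hx _ (ih z hz)
      simpa [List.replicate_succ] using this
  induction ws with
  | nil =>
    intro h
    obtain ⟨z, hz⟩ := hK
    obtain ⟨y, hy⟩ := h _ (hx z hz)
    rw [mem_boundedExpr_nil] at hy
    simp at hy
  | cons w ws ih =>
    intro h
    refine ih fun z hz => ?_
    obtain ⟨y₁, hy₁⟩ := hb z hz
    -- The block of `w.length` copies followed by `b` cannot fit into the factor `w*`. So that
    -- factor ends before `z` starts, and `z` is a suffix of a word of the shorter expression.
    obtain ⟨y, hy⟩ := h _ (hpow w.length _ hy₁)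
    obtain ⟨k, r, hr, he⟩ := mem_boundedExpr_cons.1 hy
    have he' : (y ++ ((List.replicate w.length (a :: x)).flatten ++ [b])) ++ y₁ ++ z =
        (List.replicate k w).flatten ++ r := by
      rw [← he]; simp
    rcases List.append_eq_append_iff.1 he' with ⟨t, ht, ht'⟩ | ⟨t, ht, ht'⟩
    · refine absurd ?_ (not_isPrefix_replicate_of_ne hab x y w k)
      exact ⟨y₁ ++ t, by rw [ht]; simp⟩
    · exact ⟨t, ht' ▸ hr⟩

end BoundedExpr

/-! Residuals of bounded expressions -/

section Residual

variable {A : Type v}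

/-- The language `v · w₁* ⋯ wₙ*` for `p = (v, [w₁, …, wₙ])`. -/
def residualLanguage (p : List A × List (List A)) : Language A :=
  {z | ∃ r ∈ boundedExpr p.2, z = p.1 ++ r}

/-- A transition relation between pairs `(v, [w₁, …, wₙ])` that computes the residuals of
the languages `v · w₁* ⋯ wₙ*`. -/
def ResidualStep (a : A) (p q : List A × List (List A)) : Prop :=
  p = (a :: q.1, q.2) ∨ p.1 = [] ∧ ∃ i, p.2.drop i = q.2 ∧ q.2.head? = some (a :: q.1)

theorem residualLanguage_nil (ws : List (List A)) :
    residualLanguage ([], ws) = boundedExpr ws := by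
  ext z; simp [residualLanguage]; rfl

theorem nil_mem_residualLanguage {p : List A × List (List A)} :
    [] ∈ residualLanguage p ↔ p.1 = [] := by
  constructor
  · rintro ⟨r, -, h⟩
    exact (List.append_eq_nil_iff.1 h.symm).1
  · intro h
    exact ⟨[], nil_mem_boundedExpr _, by simp [h]⟩

theorem boundedExpr_drop_le (ws : List (List A)) (i : ℕ) :
    boundedExpr (ws.drop i) ≤ boundedExpr ws := by
  conv_rhs => rw [← List.take_append_drop i ws]
  exact boundedExpr_le_append_right _ _

theorem ResidualStep.cons_mem {a : A} {p q : List A × List (List A)} (h : ResidualStep a p q)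
    {z : List A} (hz : z ∈ residualLanguage q) : a :: z ∈ residualLanguage p := by
  obtain ⟨r, hr, rfl⟩ := hz
  rcases h with rfl | ⟨h, i, hi, hq⟩
  · exact ⟨r, hr, rfl⟩
  · refine ⟨_, boundedExpr_drop_le _ i ?_, by rw [h]; rfl⟩
    rw [hi]
    obtain ⟨v, _ | ⟨w, ws⟩⟩ := q
    · simp at hq
    · obtain rfl : w = a :: v := by simpa using hq
      obtain ⟨k, r', hr', rfl⟩ := mem_boundedExpr_cons.1 hr
      exact mem_boundedExpr_cons.2 ⟨k + 1, r', hr', by simp [List.replicate_succ]⟩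

/-- Skip the factors that contribute the empty word. The factor that supplies `a` stays in the list,
because it may be repeated. -/
theorem exists_drop_of_cons_mem_boundedExpr {a : A} {ws : List (List A)} {z : List A}
    (hz : a :: z ∈ boundedExpr ws) :
    ∃ i v, (ws.drop i).head? = some (a :: v) ∧ z ∈ residualLanguage (v, ws.drop i) := by
  induction ws with
  | nil => simp [mem_boundedExpr_nil] at hz
  | cons w ws ih =>
    obtain ⟨k, r, hr, he⟩ := mem_boundedExpr_cons.1 hz
    by_cases hk : (List.replicate k w).flatten = []
    · rw [hk, List.nil_append] at he
      obtain ⟨i, v, h⟩ := ih (he ▸ hr)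
      exact ⟨i + 1, v, by simpa using h⟩
    · obtain _ | k := k
      · simp at hk
      obtain _ | ⟨c, v⟩ := w
      · simp at hk
      simp only [List.replicate_succ, List.flatten_cons, List.cons_append,
        List.cons.injEq] at he
      obtain ⟨rfl, rfl⟩ := he
      exact ⟨0, v, by simp, _, mem_boundedExpr_cons.2 ⟨k, r, hr, rfl⟩, by simp⟩

theorem exists_residualStep {a : A} {p : List A × List (List A)} {z : List A}
    (hz : a :: z ∈ residualLanguage p) :
    ∃ q, ResidualStep a p q ∧ z ∈ residualLanguage q := by
  obtain ⟨_ | ⟨c, v⟩, ws⟩ := p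
  · rw [residualLanguage_nil] at hz
    obtain ⟨i, v, h, hz⟩ := exists_drop_of_cons_mem_boundedExpr hz
    exact ⟨_, .inr ⟨rfl, i, rfl, h⟩, hz⟩
  · obtain ⟨r, hr, he⟩ := hz
    simp only [List.cons_append, List.cons.injEq] at he
    obtain ⟨rfl, rfl⟩ := he
    exact ⟨(v, ws), .inl rfl, r, hr, rfl⟩

/-- A finite set that contains the pairs reachable from `([], ws)`. -/
def residualStates (ws : List (List A)) : Set (List A × List (List A)) :=
  {p | (∃ w ∈ [] :: ws, p.1 <:+ w) ∧ p.2 <:+ ws}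

theorem finite_residualStates (ws : List (List A)) : (residualStates ws).Finite := by
  have h : ∀ {B : Type v} (l : List B), {t | t <:+ l}.Finite := fun l => by
    refine (List.finite_toSet l.tails).subset fun t ht => ?_
    simpa using ht
  refine (Set.Finite.prod (Set.Finite.biUnion (List.finite_toSet ([] :: ws))
    fun w _ => h w) (h ws)).subset ?_
  rintro ⟨v, r⟩ ⟨⟨w, hw, hv⟩, hr⟩
  exact ⟨Set.mem_biUnion (x := w) hw hv, hr⟩

theorem ResidualStep.mem_residualStates {a : A} {ws : List (List A)}
    {p q : List A × List (List A)} (h : ResidualStep a p q) (hp : p ∈ residualStates ws) :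
    q ∈ residualStates ws := by
  obtain ⟨⟨w, hw, hv⟩, hr⟩ := hp
  rcases h with rfl | ⟨-, i, hi, hq⟩
  · exact ⟨⟨w, hw, (List.suffix_cons _ _).trans hv⟩, hr⟩
  · have hs : q.2 <:+ ws := hi ▸ (List.drop_suffix _ _).trans hr
    refine ⟨⟨a :: q.1, List.mem_cons_of_mem _ (hs.subset (List.mem_of_head? hq)),
      List.suffix_cons _ _⟩, hs⟩

end Residual

/-! Partial continuous functions -/

section PartialContinuous

variable {S : Type u} [PartialOrder S]

theorem IsPartialContinuous.directedOn_image {R : S → S → Prop} (hR : IsPartialContinuous R)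
    {D : Set S} (hD : DirectedOn (· ≤ ·) D) : DirectedOn (· ≤ ·) {t | ∃ s ∈ D, R s t} := by
  rintro t₁ ⟨s₁, hs₁, h₁⟩ t₂ ⟨s₂, hs₂, h₂⟩
  obtain ⟨s, hs, h1s, h2s⟩ := hD s₁ hs₁ s₂ hs₂
  obtain ⟨t, ht, hst⟩ := hR.monotonic _ _ _ h1s h₁
  obtain ⟨t', ht', hst'⟩ := hR.monotonic _ _ _ h2s h₂
  obtain rfl := hR.functional _ _ _ hst hst'
  exact ⟨t, ⟨s, hs, hst⟩, ht, ht'⟩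

/-- The part of a directed set inside an upper set that it meets is cofinal. -/
theorem isLUB_inter_of_isUpperSet {D U : Set S} (hD : DirectedOn (· ≤ ·) D)
    (hU : IsUpperSet U) (hne : (D ∩ U).Nonempty) {x : S} (hx : IsLUB D x) :
    DirectedOn (· ≤ ·) (D ∩ U) ∧ IsLUB (D ∩ U) x := by
  constructor
  · rintro a ⟨ha, ha'⟩ b ⟨hb, -⟩
    obtain ⟨c, hc, hac, hbc⟩ := hD a ha b hb
    exact ⟨c, ⟨hc, hU hac ha'⟩, hac, hbc⟩
  · refine ⟨fun a ha => hx.1 ha.1, fun y hy => hx.2 fun a ha => ?_⟩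
    obtain ⟨b, hb, hb'⟩ := hne
    obtain ⟨c, hc, hac, hbc⟩ := hD a ha b hb
    exact hac.trans (hy ⟨hc, hU hbc hb'⟩)

theorem IsPartialContinuous.isOrderOpen_preimage {R : S → S → Prop} (hR : IsPartialContinuous R)
    {O : Set S} (hO : IsOrderOpen O) : IsOrderOpen {s | ∃ t ∈ O, R s t} := by
  constructor
  · rintro s s' hs ⟨t, ht, hst⟩
    obtain ⟨t', ht', h⟩ := hR.monotonic _ _ _ hs hst
    exact ⟨t', hO.1 ht' ht, h⟩
  · rintro D hne hD x hx ⟨t, ht, hxt⟩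
    -- `D` need not lie in the domain, but it meets it since the domain is open. Lub preservation is
    -- applied to the cofinal part inside.
    have hne' := hR.dom_open.2 hne hD hx ⟨t, hxt⟩
    obtain ⟨hD', hx'⟩ := isLUB_inter_of_isUpperSet hD hR.dom_open.1 hne' hx
    have hlub := hR.map_lub _ hne' hD' Set.inter_subset_right x t hx' hxt
    have hne'' : {t | ∃ s ∈ D ∩ relDom R, R s t}.Nonempty := by
      obtain ⟨s, hs, t', hst'⟩ := hne'
      exact ⟨t', s, ⟨hs, t', hst'⟩, hst'⟩
    obtain ⟨t', ⟨s, hs, hst'⟩, ht'⟩ := hO.2 hne'' (hR.directedOn_image hD') hlub ht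
    exact ⟨s, hs.1, t', ht', hst'⟩

theorem isPartialContinuous_eq : IsPartialContinuous (Eq : S → S → Prop) where
  functional := by
    rintro s t t' rfl rfl
    rfl
  monotonic := by
    rintro s₁ s₂ _ h rfl
    exact ⟨s₂, h, rfl⟩
  dom_open := by
    have : relDom (Eq : S → S → Prop) = Set.univ := Set.eq_univ_of_forall fun s => ⟨s, rfl⟩
    rw [this]
    exact ⟨isUpperSet_univ, fun d hd _ _ _ _ => by simpa using hd⟩
  map_lub := by
    rintro D - - - x _ hx rfl
    simpa using hx

theorem IsPartialContinuous.comp {R R' : S → S → Prop} (hR : IsPartialContinuous R)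
    (hR' : IsPartialContinuous R') : IsPartialContinuous fun s t => ∃ m, R s m ∧ R' m t where
  functional := by
    rintro s t t' ⟨m, h, h'⟩ ⟨m', k, k'⟩
    obtain rfl := hR.functional _ _ _ h k
    exact hR'.functional _ _ _ h' k'
  monotonic := by
    rintro s₁ s₂ s₃ h ⟨m, h₁, h₂⟩
    obtain ⟨m', hm, h₁'⟩ := hR.monotonic _ _ _ h h₁
    obtain ⟨s₄, hs, h₂'⟩ := hR'.monotonic _ _ _ hm h₂
    exact ⟨s₄, hs, m', h₁', h₂'⟩
  dom_open := by
    have : relDom (fun s t => ∃ m, R s m ∧ R' m t) = {s | ∃ t ∈ relDom R', R s t} := by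
      ext s
      constructor
      · rintro ⟨t, m, h, h'⟩
        exact ⟨m, ⟨t, h'⟩, h⟩
      · rintro ⟨m, ⟨t, h'⟩, h⟩
        exact ⟨t, m, h, h'⟩
    rw [this]
    exact hR.isOrderOpen_preimage hR'.dom_open
  map_lub := by
    rintro D hne hD hdom x y hx ⟨m, hm, hy⟩
    have hlub := hR.map_lub D hne hD (fun s hs => by
      obtain ⟨t, m, h, -⟩ := hdom hs
      exact ⟨m, h⟩) x m hx hm
    have hne' : {t | ∃ s ∈ D, R s t}.Nonempty := by
      obtain ⟨s, hs⟩ := hne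
      obtain ⟨t, m, h, -⟩ := hdom hs
      exact ⟨m, s, hs, h⟩
    have := hR'.map_lub _ hne' (hR.directedOn_image hD) (by
      rintro n ⟨s, hs, hn⟩
      obtain ⟨t, n', h, h'⟩ := hdom hs
      obtain rfl := hR.functional _ _ _ hn h
      exact ⟨t, h'⟩) m y hlub hy
    convert this using 1
    ext t
    constructor
    · rintro ⟨s, hs, n, h, h'⟩
      exact ⟨n, ⟨s, hs, h⟩, h'⟩
    · rintro ⟨n, ⟨s, hs, h⟩, h'⟩
      exact ⟨s, hs, n, h, h'⟩

end PartialContinuous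

/-! Runs and accelerated runs -/

section Runs

variable {S : Type u} {A : Type v}

namespace LTS

theorem run_append (T : LTS S A) (w w' : List A) (s t : S) :
    T.run (w ++ w') s t ↔ ∃ m, T.run w s m ∧ T.run w' m t := by
  induction w generalizing s with
  | nil => simp [run]
  | cons a w ih =>
    simp only [List.cons_append, run, ih]
    constructor
    · rintro ⟨s', h, m, h', h''⟩
      exact ⟨m, ⟨s', h, h'⟩, h''⟩
    · rintro ⟨m, ⟨s', h, h'⟩, h''⟩
      exact ⟨s', h, m, h', h''⟩

theorem run_singleton (T : LTS S A) (a : A) (s t : S) : T.run [a] s t ↔ T.step a s t := by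
  simp [run]

theorem isMonotonicRel_run [Preorder S] {T : LTS S A} (hT : ∀ a, IsMonotonicRel (T.step a))
    (w : List A) : IsMonotonicRel (T.run w) := by
  induction w with
  | nil =>
    rintro s₁ s₂ _ h rfl
    exact ⟨s₂, h, rfl⟩
  | cons a w ih =>
    rintro s₁ s₂ s₃ h ⟨m, h₁, h₂⟩
    obtain ⟨m', hm, h₁'⟩ := hT a _ _ _ h h₁
    obtain ⟨s₄, hs, h₂'⟩ := ih _ _ _ hm h₂
    exact ⟨s₄, hs, m', h₁', h₂'⟩

theorem isPartialContinuous_run [PartialOrder S] {T : LTS S A}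
    (hT : ∀ a, IsPartialContinuous (T.step a)) (w : List A) :
    IsPartialContinuous (T.run w) := by
  induction w with
  | nil => exact isPartialContinuous_eq
  | cons a w ih => exact (hT a).comp ih

variable [PartialOrder S]

theorem exists_monotone_chain {T : LTS S A} (hT : ∀ a, IsPartialContinuous (T.step a))
    {w : List A} {s s' : S} (h : T.run w s s') (hle : s ≤ s') :
    ∃ f : ℕ → S, Monotone f ∧ f 0 = s ∧ f 1 = s' ∧ (∀ n, T.run w (f n) (f (n + 1))) ∧
      {x | ∃ n : ℕ, T.run (List.replicate n w).flatten s x} = Set.range f := by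
  have hw := isPartialContinuous_run hT w
  -- The iteration carries a `w`-step together with its increase; monotonicity makes the next
  -- `w`-step increasing as well.
  have hex : ∀ p : {p : S × S // T.run w p.1 p.2 ∧ p.1 ≤ p.2},
      ∃ q : {p : S × S // T.run w p.1 p.2 ∧ p.1 ≤ p.2}, q.1.1 = p.1.2 := by
    rintro ⟨⟨a, b⟩, hab, hle⟩
    obtain ⟨c, hbc, hc⟩ := hw.monotonic _ _ _ hle hab
    exact ⟨⟨(b, c), hc, hbc⟩, rfl⟩
  choose next hnext using hex
  let g : ℕ → {p : S × S // T.run w p.1 p.2 ∧ p.1 ≤ p.2} := fun n => next^[n] ⟨(s, s'), h, hle⟩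
  have hg : ∀ n, (g (n + 1)).1.1 = (g n).1.2 := fun n => by
    simp only [g, Function.iterate_succ_apply']
    exact hnext _
  have hrun : ∀ n, T.run w (g n).1.1 (g (n + 1)).1.1 := fun n => by
    rw [hg]
    exact (g n).2.1
  have hpow : ∀ n, T.run (List.replicate n w).flatten s (g n).1.1 := fun n => by
    induction n with
    | zero => rfl
    | succ n ih =>
      rw [List.replicate_succ', List.flatten_append, run_append]
      exact ⟨_, ih, by simpa using hrun n⟩
  refine ⟨fun n => (g n).1.1, monotone_nat_of_le_succ fun n => ?_, rfl, hg 0, hrun, ?_⟩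
  · rw [hg]
    exact (g n).2.2
  · ext x
    constructor
    · rintro ⟨n, hn⟩
      exact ⟨n, (isPartialContinuous_run hT _).functional _ _ _ (hpow n) hn⟩
    · rintro ⟨n, rfl⟩
      exact ⟨n, hpow n⟩

/-- The lub lies in the domain of `w`, which is upward closed. By continuity its image is the lub of
the shifted chain, hence the lub itself, so it is a fixed point of `w`. -/
theorem exists_lubAccel (hS : IsDcpo S) {T : LTS S A}
    (hT : ∀ a, IsPartialContinuous (T.step a)) {w : List A} {s s' : S} (h : T.run w s s')
    (hle : s ≤ s') : ∃ t, T.lubAccel w s t ∧ s' ≤ t ∧ T.run w t t := by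
  obtain ⟨f, hf, hf0, hf1, hrun, hset⟩ := exists_monotone_chain hT h hle
  have hdir : DirectedOn (· ≤ ·) (Set.range f) := hf.directed_le.directedOn_range
  obtain ⟨t, ht⟩ := hS _ (Set.range_nonempty f) hdir
  have hw := isPartialContinuous_run hT w
  obtain ⟨t', htt'⟩ : t ∈ relDom (T.run w) :=
    hw.dom_open.1 (ht.1 ⟨0, hf0⟩) ⟨s', h⟩
  have hdom : Set.range f ⊆ relDom (T.run w) := by
    rintro _ ⟨n, rfl⟩
    exact ⟨_, hrun n⟩
  have hlub := hw.map_lub _ (Set.range_nonempty f) hdir hdom t t' ht htt'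
  have heq : t' = t := by
    refine hlub.unique ⟨?_, fun b hb => ht.2 ?_⟩
    · rintro _ ⟨_, ⟨n, rfl⟩, hn⟩
      rw [hw.functional _ _ _ hn (hrun n)]
      exact ht.1 ⟨n + 1, rfl⟩
    · rintro _ ⟨n, rfl⟩
      exact (hf n.le_succ).trans (hb ⟨_, ⟨n, rfl⟩, hrun n⟩)
  refine ⟨t, ⟨⟨s', h, hle⟩, hset ▸ ht⟩, ht.1 ⟨1, hf1⟩, heq ▸ htt'⟩

/-- The powers of `w` form a directed chain, so an open set containing its lub already contains a
state reached by a finite power. -/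
theorem lubAccel.exists_run_mem {T : LTS S A} (hT : ∀ a, IsPartialContinuous (T.step a))
    {w : List A} {s t : S} (h : T.lubAccel w s t) {O : Set S} (hO : IsOrderOpen O)
    (ht : t ∈ O) : ∃ y, ∃ x ∈ O, T.run y s x := by
  obtain ⟨⟨s', hs', hle⟩, hlub⟩ := h
  obtain ⟨f, hf, -, -, -, hset⟩ := exists_monotone_chain hT hs' hle
  rw [hset] at hlub
  obtain ⟨x, hx, hxO⟩ := hO.2 (Set.range_nonempty f) hf.directed_le.directedOn_range hlub ht
  rw [← hset] at hx
  obtain ⟨n, hn⟩ := hx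
  exact ⟨_, x, hxO, hn⟩

/-- One transition or one lub-acceleration of a nonempty word. -/
def AccelStep (T : LTS S A) (s t : S) : Prop :=
  (∃ a, T.step a s t) ∨ ∃ w, w ≠ [] ∧ T.lubAccel w s t

/-- Reachability by transitions and lub-accelerations. -/
def AccelReach (T : LTS S A) : S → S → Prop :=
  Relation.ReflTransGen T.AccelStep

theorem AccelReach.of_run {T : LTS S A} {w : List A} {s t : S} (h : T.run w s t) :
    T.AccelReach s t := by
  induction w generalizing s with
  | nil => exact h ▸ .refl
  | cons a w ih =>
    obtain ⟨m, hm, h⟩ := h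
    exact .head (.inl ⟨a, hm⟩) (ih h)

end LTS

/-! ### Increasing forks characterize unboundedness -/

namespace WSTS

/-- The words that lead from `s` to a final state. -/
def languageFrom [Preorder S] (W : WSTS S A) (s : S) : Language A :=
  {w | ∃ t ∈ W.final, W.run w s t}

theorem cons_mem_languageFrom [Preorder S] {W : WSTS S A} {a : A} {z : List A} {s : S} :
    a :: z ∈ W.languageFrom s ↔ ∃ t, W.step a s t ∧ z ∈ W.languageFrom t := by
  constructor
  · rintro ⟨t, ht, m, hm, h⟩
    exact ⟨m, hm, t, ht, h⟩
  · rintro ⟨m, hm, t, ht, h⟩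
    exact ⟨t, ht, m, hm, h⟩

theorem append_mem_languageFrom [Preorder S] {W : WSTS S A} {y z : List A} {s : S} :
    y ++ z ∈ W.languageFrom s ↔ ∃ t, W.run y s t ∧ z ∈ W.languageFrom t := by
  constructor
  · rintro ⟨t, ht, h⟩
    obtain ⟨m, hm, h⟩ := (LTS.run_append _ _ _ _ _).1 h
    exact ⟨m, hm, t, ht, h⟩
  · rintro ⟨m, hm, t, ht, h⟩
    exact ⟨t, ht, (LTS.run_append _ _ _ _ _).2 ⟨m, hm, h⟩⟩

theorem languageFrom_mono [Preorder S] (W : WSTS S A) {s t : S} (h : s ≤ t) :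
    W.languageFrom s ≤ W.languageFrom t := by
  rintro z ⟨x, hx, hsx⟩
  obtain ⟨y, hy, hty⟩ := LTS.isMonotonicRel_run W.monotonic z _ _ _ h hsx
  exact ⟨y, W.final_upper hy hx, hty⟩

variable [PartialOrder S]

theorem isOrderOpen_languageFrom {W : WSTS S A} (hW : W.IsCompleteDeterministic)
    (hF : IsOrderOpen W.final) (z : List A) : IsOrderOpen {s | z ∈ W.languageFrom s} :=
  (LTS.isPartialContinuous_run hW.continuous_step z).isOrderOpen_preimage hF

/-- Accelerations are removed from the last one backwards. At each one, the states accepting the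
word built so far form an open set, so finitely many iterations suffice. The number of iterations
depends on `z`. -/
theorem exists_append_mem_of_accelReach {W : WSTS S A} (hW : W.IsCompleteDeterministic)
    (hF : IsOrderOpen W.final) {s t : S} (h : W.AccelReach s t) {z : List A}
    (hz : z ∈ W.languageFrom t) : ∃ y, y ++ z ∈ W.languageFrom s := by
  induction h using Relation.ReflTransGen.head_induction_on with
  | refl => exact ⟨[], hz⟩
  | @head s m hsm _ ih =>
    obtain ⟨y, hy⟩ := ih
    obtain ⟨a, ha⟩ | ⟨w, -, hw⟩ := hsm
    · exact ⟨a :: y, cons_mem_languageFrom.2 ⟨m, ha, hy⟩⟩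
    · obtain ⟨x, r, hr, hsr⟩ := hw.exists_run_mem hW.continuous_step
        (isOrderOpen_languageFrom hW hF (y ++ z)) hy
      refine ⟨x ++ y, ?_⟩
      rw [List.append_assoc]
      exact append_mem_languageFrom.2 ⟨r, hsr, hr⟩

/-- An increasing fork: two runs that leave a state with different letters and lead to larger
states, the second one possibly with lub-accelerations. -/
def HasIncreasingFork (W : WSTS S A) : Prop :=
  ∃ (s : S) (a b : A) (x x' y y' : S), W.AccelReach W.init s ∧ a ≠ b ∧
    W.step a s x ∧ (∃ w, W.run w x x') ∧ s ≤ x' ∧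
    W.step b s y ∧ W.AccelReach y y' ∧ s ≤ y' ∧ ∃ z, z ∈ W.languageFrom s

theorem HasIncreasingFork.not_isBoundedLanguage {W : WSTS S A} (h : W.HasIncreasingFork)
    (hW : W.IsCompleteDeterministic) (hF : IsOrderOpen W.final) :
    ¬ IsBoundedLanguage W.language := by
  rintro ⟨ws, hws⟩
  obtain ⟨s, a, b, x, x', y, y', hs, hab, hx, ⟨w, hw⟩, hx', hy, hyy', hy', z₀, hz₀⟩ := h
  refine not_forall_suffix_boundedExpr (K := {z | z ∈ W.languageFrom s}) ⟨z₀, hz₀⟩ hab (x := w)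
    (fun z hz => ?_) (fun z hz => ?_) ws fun z hz => ?_
  · exact cons_mem_languageFrom.2 ⟨x, hx, append_mem_languageFrom.2
      ⟨x', hw, W.languageFrom_mono hx' hz⟩⟩
  · obtain ⟨r, hr⟩ := exists_append_mem_of_accelReach hW hF hyy' (W.languageFrom_mono hy' hz)
    exact ⟨r, cons_mem_languageFrom.2 ⟨y, hy, hr⟩⟩
  · obtain ⟨r, hr⟩ := exists_append_mem_of_accelReach hW hF hs hz
    exact ⟨r, hws hr⟩

theorem isBoundedLanguage_mono {L L' : Language A} (h : L ≤ L') (h' : IsBoundedLanguage L') :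
    IsBoundedLanguage L :=
  h'.imp fun _ h'' => h.trans h''

/-- By determinism, the nonempty words split into finitely many classes by their first letter, each
being that letter followed by the language of a single successor. -/
theorem exists_step_not_isBoundedLanguage [Finite A] {W : WSTS S A}
    (hW : W.IsCompleteDeterministic) {s : S} (hs : ¬ IsBoundedLanguage (W.languageFrom s)) :
    ∃ t, ¬ IsBoundedLanguage (W.languageFrom t) ∧ ∃ a, W.step a s t := by
  by_contra! hcon
  let M : A → Language A := fun a => {x | ∃ z t, x = a :: z ∧ W.step a s t ∧ z ∈ W.languageFrom t}
  have hM : ∀ a, IsBoundedLanguage (M a) := by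
    intro a
    by_cases h : ∃ t, W.step a s t
    · obtain ⟨t, ht⟩ := h
      have : IsBoundedLanguage (W.languageFrom t) := by
        by_contra h
        exact hcon t h a ht
      obtain ⟨ws, hws⟩ := this
      refine ⟨[a] :: ws, ?_⟩
      rintro _ ⟨z, t', rfl, ht', hz⟩
      obtain rfl := hW.deterministic a _ _ _ ht ht'
      exact append_mem_boundedExpr (self_mem_boundedExpr [a]) (hws hz)
    · refine ⟨[], ?_⟩
      rintro _ ⟨z, t', rfl, ht', hz⟩
      exact absurd ⟨t', ht'⟩ h
  obtain ⟨ws, hws⟩ := IsBoundedLanguage.iUnion hM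
  refine hs ⟨ws, ?_⟩
  rintro (_ | ⟨a, z⟩) hz
  · exact nil_mem_boundedExpr _
  · obtain ⟨t, ht, hz⟩ := cons_mem_languageFrom.1 hz
    exact hws a ⟨z, t, rfl, ht, hz⟩

theorem prefix_or_prefix_or_exists_ne (u z : List A) :
    u <+: z ∨ z <+: u ∨ ∃ p a q b r, u = p ++ a :: q ∧ z = p ++ b :: r ∧ a ≠ b := by
  induction u generalizing z with
  | nil => exact .inl List.nil_prefix
  | cons c u ih =>
    cases z with
    | nil => exact .inr (.inl List.nil_prefix)
    | cons d z =>
      by_cases hcd : c = d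
      · subst hcd
        rcases ih z with h | h | ⟨p, a, q, b, r, rfl, rfl, h⟩
        · exact .inl (by simpa using h)
        · exact .inr (.inl (by simpa using h))
        · exact .inr (.inr ⟨c :: p, a, q, b, r, rfl, rfl, h⟩)
      · exact .inr (.inr ⟨[], c, u, d, z, rfl, rfl, hcd⟩)

/-- After going round the loop as often as possible, an accepted word either stops within `u` or
leaves it at one of finitely many positions with one of finitely many letters. If all exits were
bounded, `u*` followed by a bounded expression would cover everything. -/
theorem exists_branch_not_isBoundedLanguage [Finite A] {W : WSTS S A}
    (hW : W.IsCompleteDeterministic) {u : List A} (hu : u ≠ []) {t : S} (hut : W.run u t t)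
    (ht : ¬ IsBoundedLanguage (W.languageFrom t)) :
    ∃ p a q b x y, u = p ++ a :: q ∧ a ≠ b ∧ W.run p t x ∧ W.step b x y ∧
      ¬ IsBoundedLanguage (W.languageFrom y) := by
  by_contra! hcon
  have hfin : {p | p <+: u}.Finite :=
    (List.finite_toSet u.inits).subset fun p hp => by simpa using hp
  have := hfin.to_subtype
  have hrun : ∀ w, IsPartialFunction (W.run w) := fun w =>
    (LTS.isPartialContinuous_run hW.continuous_step w).functional
  let M : {p | p <+: u} × A → Language A := fun i => {z | ∃ a q x y r, u = i.1.1 ++ a :: q ∧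
    a ≠ i.2 ∧ W.run i.1.1 t x ∧ W.step i.2 x y ∧ z = i.1.1 ++ i.2 :: r ∧ r ∈ W.languageFrom y}
  have hM : ∀ i, IsBoundedLanguage (M i) := by
    rintro ⟨⟨p, hp⟩, b⟩
    by_cases h : ∃ a q x y, u = p ++ a :: q ∧ a ≠ b ∧ W.run p t x ∧ W.step b x y
    · obtain ⟨a, q, x, y, hu, hab, hx, hy⟩ := h
      obtain ⟨ws, hws⟩ := hcon p a q b x y hu hab hx hy
      refine ⟨[p ++ [b]] ++ ws, ?_⟩
      rintro _ ⟨_, _, x', y', r, -, -, hx', hy', rfl, hr⟩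
      obtain rfl := hrun _ _ _ _ hx hx'
      obtain rfl := hW.deterministic b _ _ _ hy hy'
      have := append_mem_boundedExpr (self_mem_boundedExpr (p ++ [b])) (hws hr)
      rw [List.append_assoc] at this
      exact this
    · refine ⟨[], ?_⟩
      rintro _ ⟨a, q, x, y, r, hu, hab, hx, hy, -⟩
      exact absurd ⟨a, q, x, y, hu, hab, hx, hy⟩ h
  obtain ⟨ws, hws⟩ := IsBoundedLanguage.iUnion hM
  obtain ⟨ws', hws'⟩ := IsBoundedLanguage.iUnion (ι := {p | p <+: u})
    (L := fun p => ({p.1} : Language A)) fun p => ⟨[p.1], by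
      rintro _ rfl
      exact self_mem_boundedExpr _⟩
  refine ht ⟨u :: (ws' ++ ws), ?_⟩
  -- Removing one turn of the loop shortens the word because `u ≠ []`, and the rest is again
  -- accepted from `t`.
  suffices ∀ n z, z.length = n → z ∈ W.languageFrom t → z ∈ boundedExpr (u :: (ws' ++ ws)) from
    fun z hz => this _ z rfl hz
  intro n
  induction n using Nat.strong_induction_on with
  | _ n ih =>
    intro z hn hz
    rcases prefix_or_prefix_or_exists_ne u z with ⟨z, rfl⟩ | h | ⟨p, a, q, b, r, hp, rfl, hab⟩
    · obtain ⟨t', ht', hz⟩ := append_mem_languageFrom.1 hz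
      obtain rfl := hrun _ _ _ _ hut ht'
      have hlt : z.length < n := by
        have := List.length_pos_iff.2 hu
        rw [← hn, List.length_append]
        omega
      obtain ⟨k, r, hr, rfl⟩ := mem_boundedExpr_cons.1 (ih _ hlt z rfl hz)
      exact mem_boundedExpr_cons.2 ⟨k + 1, r, hr, by simp [List.replicate_succ]⟩
    · refine boundedExpr_le_append_right [u] _ (boundedExpr_le_append_left ws' ws ?_)
      exact hws' ⟨z, h⟩ rfl
    · refine boundedExpr_le_append_right [u] _ (boundedExpr_le_append_right ws' ws ?_)
      obtain ⟨x, hx, hr⟩ := append_mem_languageFrom.1 hz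
      obtain ⟨y, hy, hr⟩ := cons_mem_languageFrom.1 hr
      exact hws ⟨⟨p, a :: q, hp.symm⟩, b⟩ ⟨a, q, x, y, r, hp, hab, hx, hy, rfl, hr⟩

theorem exists_loop_not_isBoundedLanguage [Finite A] {W : WSTS S A}
    (hW : W.IsCompleteDeterministic) {s : S} (hs : ¬ IsBoundedLanguage (W.languageFrom s)) :
    ∃ t y, W.AccelReach s t ∧ ¬ IsBoundedLanguage (W.languageFrom y) ∧
      ∃ a b x w, a ≠ b ∧ W.step a t x ∧ W.run w x t ∧ W.step b t y := by
  choose! f hf hf' using fun t (ht : ¬ IsBoundedLanguage (W.languageFrom t)) =>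
    exists_step_not_isBoundedLanguage hW ht
  have hg : ∀ n, ¬ IsBoundedLanguage (W.languageFrom (f^[n] s)) := fun n => by
    induction n with
    | zero => exact hs
    | succ n ih =>
      rw [Function.iterate_succ_apply']
      exact hf _ ih
  have hrun : ∀ i k, ∃ w : List A, w.length = k ∧ W.run w (f^[i] s) (f^[i + k] s) := by
    intro i k
    induction k with
    | zero => exact ⟨[], rfl, rfl⟩
    | succ k ih =>
      obtain ⟨w, hw, h⟩ := ih
      obtain ⟨a, ha⟩ := hf' _ (hg (i + k))
      refine ⟨w ++ [a], by simp [hw], (LTS.run_append _ _ _ _ _).2 ⟨_, h, ?_⟩⟩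
      rw [← Nat.add_assoc, Function.iterate_succ_apply']
      exact (LTS.run_singleton _ _ _ _).2 ha
  -- The states of an infinite run through unbounded languages contain an increasing pair. The
  -- acceleration of the word between them lies above the later state, so its language is unbounded
  -- too.
  obtain ⟨i, j, hij, hle⟩ := W.wqo fun n => f^[n] s
  obtain ⟨k, rfl⟩ := Nat.exists_eq_add_of_le hij.le
  obtain ⟨u, hu, hurun⟩ := hrun i k
  have hu0 : u ≠ [] := by
    rintro rfl
    simp at hu
    omega
  obtain ⟨t, ht, htle, htt⟩ := LTS.exists_lubAccel hW.continuous_dcpo.1 hW.continuous_step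
    hurun hle
  have htunb : ¬ IsBoundedLanguage (W.languageFrom t) := fun h =>
    hg _ (isBoundedLanguage_mono (W.languageFrom_mono htle) h)
  obtain ⟨p, a, q, b, x, y, rfl, hab, hx, hy, hyunb⟩ :=
    exists_branch_not_isBoundedLanguage hW hu0 htt htunb
  obtain ⟨v, -, hv⟩ := hrun 0 i
  rw [Nat.zero_add] at hv
  obtain ⟨x', hx', m, hm, hq⟩ := (LTS.run_append _ _ _ _ _).1 htt
  obtain rfl := (LTS.isPartialContinuous_run hW.continuous_step p).functional _ _ _ hx hx'
  -- The loop `p ++ a :: q` is rotated so as to start at the branching state `x`.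
  refine ⟨x, y, ?_, hyunb, a, b, m, q ++ p, hab, hm, (LTS.run_append _ _ _ _ _).2 ⟨t, hq, hx⟩, hy⟩
  exact ((LTS.AccelReach.of_run hv).tail (.inr ⟨_, hu0, ht⟩)).trans (LTS.AccelReach.of_run hx)

theorem hasIncreasingFork_of_not_isBoundedLanguage [Finite A] {W : WSTS S A}
    (hW : W.IsCompleteDeterministic) (h : ¬ IsBoundedLanguage W.language) :
    W.HasIncreasingFork := by
  choose! t y hty hy hloop using fun s (hs : ¬ IsBoundedLanguage (W.languageFrom s)) =>
    exists_loop_not_isBoundedLanguage hW hs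
  have hunb : ∀ n, ¬ IsBoundedLanguage (W.languageFrom (y^[n] W.init)) := fun n => by
    induction n with
    | zero => exact h
    | succ n ih =>
      rw [Function.iterate_succ_apply']
      exact hy _ ih
  have hreach : ∀ i k, W.AccelReach (y^[i] W.init) (y^[i + k] W.init) := by
    intro i k
    induction k with
    | zero => exact .refl
    | succ k ih =>
      obtain ⟨a, b, x, w, -, -, -, hb⟩ := hloop _ (hunb (i + k))
      refine ih.trans ?_
      rw [← Nat.add_assoc, Function.iterate_succ_apply']
      exact (hty _ (hunb _)).tail (.inl ⟨b, hb⟩)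
  -- In the fork at the earlier loop state, the `a`-run is the loop itself, returning to exactly the
  -- same state. The `b`-run leaves the loop and reaches the later, larger loop state.
  obtain ⟨i, j, hij, hle⟩ := W.wqo fun n => t (y^[n] W.init)
  obtain ⟨k, rfl⟩ := Nat.exists_eq_add_of_lt hij
  obtain ⟨a, b, x, w, hab, hx, hw, hb⟩ := hloop _ (hunb i)
  have hnext := hunb (i + 1)
  have hfrom := hreach (i + 1) k
  rw [Function.iterate_succ_apply'] at hnext hfrom
  refine ⟨t (y^[i] W.init), a, b, x, _, _, t (y^[i + k + 1] W.init), ?_, hab, hx, ⟨w, hw⟩,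
    le_rfl, hb, ?_, hle, ?_⟩
  · have := hreach 0 i
    rw [Nat.zero_add] at this
    exact this.trans (hty _ (hunb i))
  · rw [show i + 1 + k = i + k + 1 by omega] at hfrom
    exact hfrom.trans (hty _ (hunb _))
  · by_contra! hempty
    -- Otherwise the `b`-successor would have the empty language, which is bounded.
    refine hnext ⟨[], fun z hz => absurd ?_ (hempty (b :: z))⟩
    exact cons_mem_languageFrom.2 ⟨_, hb, hz⟩

end WSTS

end Runs

/-! Programs of a description -/

theorem Computes.unique {X Y : Type} [Encodable X] [Encodable Y] {c : Code} {x : X} {y y' : Y}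
    (h : Computes c x y) (h' : Computes c x y') : y = y' :=
  Encodable.encode_injective (Part.mem_unique h h')

theorem computes_true_iff {X : Type} [Encodable X] {c : Code} {x : X} {p : Prop}
    (h : ∃ b : Bool, Computes c x b ∧ (b = true ↔ p)) : Computes c x true ↔ p := by
  obtain ⟨b, hb, hp⟩ := h
  rw [← hp]
  constructor
  · intro h
    exact hb.unique h
  · rintro rfl
    exact hb

theorem computes_false_iff {X : Type} [Encodable X] {c : Code} {x : X} {p : Prop}
    (h : ∃ b : Bool, Computes c x b ∧ (b = true ↔ p)) : Computes c x false ↔ ¬ p := by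
  obtain ⟨b, hb, hp⟩ := h
  rw [← hp, Bool.not_eq_true]
  constructor
  · intro h
    exact hb.unique h
  · rintro rfl
    exact hb

/-- The minimal elements form an antichain, finite by well quasi ordering, and every element lies
above one of them by well-foundedness. -/
theorem exists_isCodedBasis {S : Type u} [PartialOrder S]
    (hwqo : WellQuasiOrdered (fun s t : S => s ≤ t)) {ν : ℕ → S} (hν : Function.Surjective ν)
    {U : Set S} (hU : IsUpperSet U) : ∃ B, IsCodedBasis ν B U := by
  have hfin : {x | Minimal (· ∈ U) x}.Finite :=
    (setOfPred_minimal_antichain (· ∈ U)).finite_of_wellQuasiOrdered hwqo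
  have : WellQuasiOrderedLE S := ⟨hwqo⟩
  choose c hc using hν
  refine ⟨hfin.toFinset.toList.map c, fun s => ⟨fun hs => ?_, ?_⟩⟩
  · obtain ⟨m, hm, hmin⟩ := exists_minimal_le_of_wellFoundedLT (· ∈ U) s hs
    exact ⟨c m, List.mem_map_of_mem (by simpa using hmin), (hc m).trans_le hm⟩
  · rintro ⟨n, hn, hle⟩
    obtain ⟨m, hm, rfl⟩ := List.mem_map.1 hn
    have hm : Minimal (· ∈ U) m := by simpa using hm
    exact hU ((hc m).symm.trans_le hle) hm.prop

/-! ### Forks and inclusion certificates on codes -/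

namespace Description

/-- The transition relations on codes. -/
def Step (d : Description) (a m n : ℕ) : Prop :=
  a < d.labels ∧ Computes d.step (a, m, n) true

/-- The order on codes. -/
def Le (d : Description) (m n : ℕ) : Prop :=
  Computes d.le (m, n) true

/-- A configuration is the unread word and the current code. This turns runs into a reflexive
transitive closure, whose semidecidability is available. -/
def ConfigStep (d : Description) (c c' : List ℕ × ℕ) : Prop :=
  ∃ a, c.1 = a :: c'.1 ∧ d.Step a c.2 c'.2

/-- Runs on codes. -/
def Run (d : Description) (w : List ℕ) (m n : ℕ) : Prop :=
  Relation.ReflTransGen d.ConfigStep (w, m) ([], n)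

/-- Transitions and lub-accelerations on codes. -/
def AccelStep (d : Description) (m n : ℕ) : Prop :=
  (∃ a, d.Step a m n) ∨
    ∃ c : List ℕ × ℕ, c.1 ≠ [] ∧ d.Run c.1 m c.2 ∧ d.Le m c.2 ∧ Computes d.accel (c.1, m) n

/-- Increasing forks, on codes. -/
def HasIncreasingFork (d : Description) : Prop :=
  ∃ s a b x x' y y' f : ℕ, ∃ w z : List ℕ, Relation.ReflTransGen d.AccelStep d.init s ∧ a ≠ b ∧
    d.Step a s x ∧ d.Run w x x' ∧ d.Le s x' ∧
    d.Step b s y ∧ Relation.ReflTransGen d.AccelStep y y' ∧ d.Le s y' ∧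
    d.Run z s f ∧ ∃ g ∈ d.final, d.Le g f

/-- A finite automaton for the words of `w₁* ⋯ wₙ*`, whose states are lists of residuals,
together with bases of the sets of states from which some word that is not accepted leads to a
final state. -/
def IsInclusionCertificate (d : Description) (ws : List (List ℕ))
    (Q : List (List (List ℕ × List (List ℕ))))
    (I : List (List (List ℕ × List (List ℕ)) × ℕ)) : Prop :=
  (∀ w ∈ ws, ∀ a ∈ w, a < d.labels) ∧ [([], ws)] ∈ Q ∧
  (∀ X ∈ Q, (∃ p ∈ X, p.1 = []) ∨ ∀ f ∈ d.final, ∃ e ∈ I, e.1 = X ∧ d.Le e.2 f) ∧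
  (∀ X ∈ Q, ∀ a ∈ List.range d.labels, ∃ X' ∈ Q,
    (∀ r ∈ X', ∃ p ∈ X, ResidualStep a p r) ∧
    ∀ e ∈ I, e.1 ≠ X' ∨ ∃ B : List ℕ, Computes d.pred (a, e.2) B ∧
      ∀ n ∈ B, ∃ e' ∈ I, e'.1 = X ∧ d.Le e'.2 n) ∧
  ∀ e ∈ I, e.1 ≠ [([], ws)] ∨ Computes d.le (e.2, d.init) false

end Description

/-! ### Correctness of the coded notions -/

namespace Describes

variable {d : Description} {S : Type u}

variable [PartialOrder S] {ν : ℕ → S} {W : WSTS S (Fin d.labels)}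

theorem le_iff (h : Describes d ν W) {m n : ℕ} : d.Le m n ↔ ν m ≤ ν n :=
  computes_true_iff (h.le m n)

theorem step_iff (h : Describes d ν W) {a m n : ℕ} :
    d.Step a m n ↔ ∃ ha : a < d.labels, W.step ⟨a, ha⟩ (ν m) (ν n) := by
  constructor
  · rintro ⟨ha, hs⟩
    exact ⟨ha, (computes_true_iff (h.step ⟨a, ha⟩ m n)).1 hs⟩
  · rintro ⟨ha, hs⟩
    exact ⟨ha, (computes_true_iff (h.step ⟨a, ha⟩ m n)).2 hs⟩

theorem exists_run (h : Describes d ν W) {w : List ℕ} {m n : ℕ} (hr : d.Run w m n) :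
    ∃ w' : List (Fin d.labels), w = w'.map Fin.val ∧ W.run w' (ν m) (ν n) := by
  suffices ∀ c, Relation.ReflTransGen d.ConfigStep c ([], n) →
      ∃ w' : List (Fin d.labels), c.1 = w'.map Fin.val ∧ W.run w' (ν c.2) (ν n) from this _ hr
  intro c hc
  induction hc using Relation.ReflTransGen.head_induction_on with
  | refl => exact ⟨[], rfl, rfl⟩
  | @head c c' hcc' _ ih =>
    obtain ⟨a, ha, hs⟩ := hcc'
    obtain ⟨w', hw', hrun⟩ := ih
    obtain ⟨ha', hs⟩ := h.step_iff.1 hs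
    exact ⟨⟨a, ha'⟩ :: w', by simp [ha, hw'], _, hs, hrun⟩

theorem exists_code_of_run (h : Describes d ν W) {w : List (Fin d.labels)} {m : ℕ} {t : S}
    (hr : W.run w (ν m) t) : ∃ n, ν n = t ∧ d.Run (w.map Fin.val) m n := by
  induction w generalizing m with
  | nil => exact ⟨m, hr, .refl⟩
  | cons a w ih =>
    obtain ⟨s, hs, hr⟩ := hr
    obtain ⟨k, rfl⟩ := h.surj s
    obtain ⟨n, hn, hrun⟩ := ih hr
    exact ⟨n, hn, .head ⟨a, rfl, h.step_iff.2 ⟨a.2, hs⟩⟩ hrun⟩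

theorem exists_code_of_accelStep (h : Describes d ν W) {m : ℕ} {t : S}
    (hs : W.AccelStep (ν m) t) : ∃ n, ν n = t ∧ d.AccelStep m n := by
  obtain ⟨a, ha⟩ | ⟨w, hw, hacc⟩ := hs
  · obtain ⟨n, rfl⟩ := h.surj t
    exact ⟨n, rfl, .inl ⟨a, h.step_iff.2 ⟨a.2, ha⟩⟩⟩
  · obtain ⟨n, hn, rfl⟩ := h.accel w hw m t hacc
    obtain ⟨⟨s', hs', hle⟩, -⟩ := hacc
    obtain ⟨k, rfl, hk⟩ := h.exists_code_of_run hs'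
    exact ⟨n, rfl, .inr ⟨(_, k), by simpa using hw, hk, h.le_iff.2 hle, hn⟩⟩

theorem exists_code_of_accelReach (h : Describes d ν W) {m : ℕ} {t : S}
    (hr : W.AccelReach (ν m) t) : ∃ n, ν n = t ∧ Relation.ReflTransGen d.AccelStep m n := by
  induction hr with
  | refl => exact ⟨m, rfl, .refl⟩
  | tail _ hs ih =>
    obtain ⟨k, rfl, hk⟩ := ih
    obtain ⟨n, hn, hkn⟩ := h.exists_code_of_accelStep hs
    exact ⟨n, hn, hk.tail hkn⟩

theorem hasIncreasingFork_code (h : Describes d ν W) (hf : W.HasIncreasingFork) :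
    d.HasIncreasingFork := by
  obtain ⟨s, a, b, x, x', y, y', hs, hab, hx, ⟨w, hw⟩, hx', hy, hyy', hy', z, t, ht, hz⟩ := hf
  rw [← h.init] at hs
  obtain ⟨s, rfl, cs⟩ := h.exists_code_of_accelReach hs
  obtain ⟨x, rfl⟩ := h.surj x
  obtain ⟨y, rfl⟩ := h.surj y
  obtain ⟨x', rfl, cw⟩ := h.exists_code_of_run hw
  obtain ⟨y', rfl, cy⟩ := h.exists_code_of_accelReach hyy'
  obtain ⟨f, rfl, cz⟩ := h.exists_code_of_run hz
  obtain ⟨g, hg, hgf⟩ := (h.final _).1 ht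
  exact ⟨s, a, b, x, x', y, y', f, _, _, cs, fun h => hab (Fin.ext h),
    h.step_iff.2 ⟨a.2, hx⟩, cw, h.le_iff.2 hx', h.step_iff.2 ⟨b.2, hy⟩, cy,
    h.le_iff.2 hy', cz, g, hg, h.le_iff.2 hgf⟩

/-- An inclusion certificate proves the inclusion. -/
theorem language_le_of_isInclusionCertificate (h : Describes d ν W) {ws : List (List ℕ)}
    {Q : List (List (List ℕ × List (List ℕ)))} {I : List (List (List ℕ × List (List ℕ)) × ℕ)}
    (hc : d.IsInclusionCertificate ws Q I) :
    ∃ ws' : List (List (Fin d.labels)), ws'.map (List.map Fin.val) = ws ∧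
      W.language ≤ boundedExpr ws' := by
  obtain ⟨hlab, hQ, hfin, hpred, hinit⟩ := hc
  have hlift : ws ∈ Set.range (List.map (List.map (Fin.val : Fin d.labels → ℕ))) := by
    rw [Set.range_list_map]
    intro w hw
    rw [Set.range_list_map]
    intro a ha
    exact ⟨⟨a, hlab w hw a ha⟩, rfl⟩
  obtain ⟨ws', rfl⟩ := hlift
  refine ⟨ws', rfl, fun z hz => ?_⟩
  -- Backward invariant: a state accepting a word that `X` rejects lies above an element of `I`
  -- tagged `X`. Soundness needs neither exact bases nor all residuals in `X'`, since both
  -- deviations only enlarge the sets to be covered.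
  suffices ∀ (w : List (Fin d.labels)) (s : S), ∀ X ∈ Q, w ∈ W.languageFrom s →
      (¬ ∃ p ∈ X, w.map Fin.val ∈ residualLanguage p) → ∃ e ∈ I, e.1 = X ∧ ν e.2 ≤ s by
    by_contra hcon
    obtain ⟨e, he, heX, hle⟩ := this z W.init _ hQ hz (by
      rintro ⟨p, hp, hzp⟩
      rw [List.mem_singleton.1 hp, residualLanguage_nil,
        map_mem_boundedExpr Fin.val_injective] at hzp
      exact hcon hzp)
    rcases hinit e he with h' | h'
    · exact h' heX
    · refine (computes_false_iff (h.le _ _)).1 h' ?_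
      rwa [h.init]
  intro w
  induction w with
  | nil =>
    rintro s X hX ⟨_, ht, rfl⟩ hnot
    rcases hfin X hX with ⟨p, hp, hp'⟩ | hfin
    · exact absurd ⟨p, hp, nil_mem_residualLanguage.2 hp'⟩ hnot
    · obtain ⟨f, hf, hle⟩ := (h.final _).1 ht
      obtain ⟨e, he, heX, hef⟩ := hfin f hf
      exact ⟨e, he, heX, (h.le_iff.1 hef).trans hle⟩
  | cons a w ih =>
    intro s X hX hw hnot
    obtain ⟨t, hst, hw⟩ := WSTS.cons_mem_languageFrom.1 hw
    obtain ⟨X', hX', hres, hI⟩ := hpred X hX a (List.mem_range.2 a.2)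
    obtain ⟨e, he, heX, hle⟩ := ih t X' hX' hw (by
      rintro ⟨r, hr, hwr⟩
      obtain ⟨p, hp, hpr⟩ := hres r hr
      exact hnot ⟨p, hp, hpr.cons_mem hwr⟩)
    rcases hI e he with h' | ⟨B, hB, hI⟩
    · exact absurd heX h'
    · obtain ⟨B', hB', hbasis⟩ := h.pred a e.2
      obtain rfl := hB.unique hB'
      obtain ⟨n, hn, hns⟩ := (hbasis s).1 ⟨s, le_rfl, t, hst, hle⟩
      obtain ⟨e', he', heX', hle'⟩ := hI n hn
      exact ⟨e', he', heX', (h.le_iff.1 hle').trans hns⟩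

theorem accelStep (h : Describes d ν W) (hW : W.IsCompleteDeterministic) {m n : ℕ}
    (hs : d.AccelStep m n) : W.AccelStep (ν m) (ν n) := by
  obtain ⟨a, ha⟩ | ⟨⟨w, k⟩, hw, hr, hle, hacc⟩ := hs
  · obtain ⟨ha, hs⟩ := h.step_iff.1 ha
    exact .inl ⟨_, hs⟩
  · obtain ⟨w, rfl, hr⟩ := h.exists_run hr
    have hw : w ≠ [] := by simpa using hw
    -- The recorded run to a larger state places `ν m` in the domain of the acceleration, so the
    -- output of the program is the true lub.
    obtain ⟨t, ht, -⟩ := LTS.exists_lubAccel hW.continuous_dcpo.1 hW.continuous_step hr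
      (h.le_iff.1 hle)
    obtain ⟨n', hn', rfl⟩ := h.accel w hw m t ht
    obtain rfl := hacc.unique hn'
    exact .inr ⟨w, hw, ht⟩

theorem accelReach (h : Describes d ν W) (hW : W.IsCompleteDeterministic) {m n : ℕ}
    (hr : Relation.ReflTransGen d.AccelStep m n) : W.AccelReach (ν m) (ν n) :=
  Relation.ReflTransGen.lift ν (fun _ _ => h.accelStep hW) _ _ hr

theorem hasIncreasingFork (h : Describes d ν W) (hW : W.IsCompleteDeterministic)
    (hf : d.HasIncreasingFork) : W.HasIncreasingFork := by
  obtain ⟨s, a, b, x, x', y, y', f, w, z, hs, hab, hx, hw, hx', hy, hyy', hy', hz, g, hg, hgf⟩ :=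
    hf
  obtain ⟨ha, hx⟩ := h.step_iff.1 hx
  obtain ⟨hb, hy⟩ := h.step_iff.1 hy
  obtain ⟨w, -, hw⟩ := h.exists_run hw
  obtain ⟨z, -, hz⟩ := h.exists_run hz
  have hs := h.accelReach hW hs
  rw [h.init] at hs
  exact ⟨ν s, ⟨a, ha⟩, ⟨b, hb⟩, _, _, _, _, hs, fun h => hab (congrArg Fin.val h), hx, ⟨w, hw⟩,
    h.le_iff.1 hx', hy, h.accelReach hW hyy', h.le_iff.1 hy', z, ν f,
    (h.final _).2 ⟨g, hg, h.le_iff.1 hgf⟩, hz⟩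

theorem exists_isInclusionCertificate (h : Describes d ν W)
    {ws : List (List (Fin d.labels))} (hle : W.language ≤ boundedExpr ws) :
    ∃ Q I, d.IsInclusionCertificate (ws.map (List.map Fin.val)) Q I := by
  classical
  set ws' := ws.map (List.map Fin.val) with hws'
  let R := (finite_residualStates ws').toFinset
  -- Subset construction: all sets of residuals, each as one canonical list, so that equality of
  -- lists matches equality of sets.
  let Q : List (List (List ℕ × List (List ℕ))) := R.powerset.toList.map Finset.toList
  have hQ : ∀ X : Finset (List ℕ × List (List ℕ)), X ⊆ R → X.toList ∈ Q := fun X hX =>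
    List.mem_map_of_mem (by simpa using hX)
  have hQR : ∀ X ∈ Q, ∀ p ∈ X, p ∈ R := by
    intro X hX p hp
    obtain ⟨Y, hY, rfl⟩ := List.mem_map.1 hX
    have hY : Y ⊆ R := by simpa using hY
    exact hY (by simpa using hp)
  -- The exact sets of states accepting a word that `X` rejects. They are upward closed, so they
  -- have finite bases, which make up `I`.
  let U : List (List ℕ × List (List ℕ)) → Set S := fun X =>
    {s | ∃ w ∈ W.languageFrom s, ¬ ∃ p ∈ X, w.map Fin.val ∈ residualLanguage p}
  have hU : ∀ X, IsUpperSet (U X) := by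
    rintro X s t hst ⟨w, hw, hn⟩
    exact ⟨w, W.languageFrom_mono hst hw, hn⟩
  choose B hB using fun X => exists_isCodedBasis W.wqo h.surj (hU X)
  let I : List (List (List ℕ × List (List ℕ)) × ℕ) := Q.flatMap fun X => (B X).map (Prod.mk X)
  have hI : ∀ X n, (X, n) ∈ I ↔ X ∈ Q ∧ n ∈ B X := by
    intro X n
    simp [I]
  have hcover : ∀ X ∈ Q, ∀ n, ν n ∈ U X → ∃ e ∈ I, e.1 = X ∧ d.Le e.2 n := by
    intro X hX n hn
    obtain ⟨m, hm, hmn⟩ := (hB X _).1 hn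
    exact ⟨(X, m), (hI _ _).2 ⟨hX, hm⟩, rfl, h.le_iff.2 hmn⟩
  have hmemU : ∀ e ∈ I, ν e.2 ∈ U e.1 := fun e he =>
    (hB e.1 _).2 ⟨e.2, ((hI e.1 e.2).1 he).2, le_rfl⟩
  refine ⟨Q, I, ?_, ?_, fun X hX => ?_, fun X hX a ha => ?_, fun e he => ?_⟩
  · intro w hw a ha
    obtain ⟨w, -, rfl⟩ := List.mem_map.1 hw
    obtain ⟨a, -, rfl⟩ := List.mem_map.1 ha
    exact a.2
  · have := hQ {([], ws')} (by
      rw [Finset.singleton_subset_iff, Set.Finite.mem_toFinset]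
      exact ⟨⟨[], by simp⟩, List.suffix_rfl⟩)
    rwa [Finset.toList_singleton] at this
  · by_cases hX' : ∃ p ∈ X, p.1 = []
    · exact .inl hX'
    · refine .inr fun f hf => hcover X hX f ⟨[], ?_, ?_⟩
      · exact ⟨ν f, (h.final _).2 ⟨f, hf, le_rfl⟩, rfl⟩
      · rintro ⟨p, hp, hp'⟩
        exact hX' ⟨p, hp, nil_mem_residualLanguage.1 hp'⟩
  · have ha : a < d.labels := List.mem_range.1 ha
    refine ⟨(R.filter fun r => ∃ p ∈ X, ResidualStep a p r).toList,
      hQ _ (Finset.filter_subset _ _), fun r hr => ?_, fun e he => ?_⟩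
    · rw [Finset.mem_toList, Finset.mem_filter] at hr
      exact hr.2
    · rw [ne_eq, ← imp_iff_not_or]
      intro heX
      obtain ⟨P, hP, hbasis⟩ := h.pred ⟨a, ha⟩ e.2
      refine ⟨P, hP, fun n hn => hcover X hX n ?_⟩
      obtain ⟨s, hs, t, hst, het⟩ := (hbasis (ν n)).2 ⟨n, hn, le_rfl⟩
      -- A word rejected by `X'` remains rejected by `X` when `a` is put in front, because `X'`
      -- contains every `a`-residual of `X`.
      refine hU X hs ?_
      obtain ⟨w, hw, hnot⟩ := hU _ het (hmemU e he)
      refine ⟨⟨a, ha⟩ :: w, WSTS.cons_mem_languageFrom.2 ⟨t, hst, hw⟩, ?_⟩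
      rintro ⟨p, hp, hwp⟩
      obtain ⟨r, hr, hwr⟩ := exists_residualStep hwp
      refine hnot ⟨r, ?_, hwr⟩
      rw [heX, Finset.mem_toList, Finset.mem_filter]
      refine ⟨?_, p, hp, hr⟩
      have := hQR X hX p hp
      rw [Set.Finite.mem_toFinset] at this ⊢
      exact hr.mem_residualStates this
  · rw [ne_eq, ← imp_iff_not_or]
    intro heX
    refine (computes_false_iff (h.le _ _)).2 fun hinit => ?_
    have hmem := hmemU e he
    rw [heX] at hmem
    obtain ⟨w, hw, hnot⟩ := hU _ hinit hmem
    rw [h.init] at hw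
    refine hnot ⟨_, List.mem_singleton_self _, ?_⟩
    rw [residualLanguage_nil, hws', map_mem_boundedExpr Fin.val_injective]
    exact hle hw

end Describes

/-! Semidecidability of forks and of inclusion certificates -/

section Primrec

variable {α β γ : Type*} [Primcodable α] [Primcodable β] [Primcodable γ]

theorem Primrec.fst_of {f : α → β × γ} (hf : Primrec f) : Primrec fun a => (f a).1 :=
  Primrec.fst.comp hf

theorem Primrec.snd_of {f : α → β × γ} (hf : Primrec f) : Primrec fun a => (f a).2 :=
  Primrec.snd.comp hf

end Primrec

namespace SemiDecidable

variable {α β γ : Type*} [Primcodable α] [Primcodable β] [Primcodable γ]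

theorem eq {f g : α → β} (hf : Primrec f) (hg : Primrec g) : SemiDecidable fun a => f a = g a :=
  of_primrecPred (Primrec.eq.comp hf hg)

theorem ne {f g : α → β} (hf : Primrec f) (hg : Primrec g) : SemiDecidable fun a => f a ≠ g a :=
  of_primrecPred (Primrec.eq.comp hf hg).not

theorem lt {f g : α → ℕ} (hf : Primrec f) (hg : Primrec g) : SemiDecidable fun a => f a < g a :=
  of_primrecPred (Primrec.nat_lt.comp hf hg)

end SemiDecidable

namespace Description

theorem primrec_equivProd : Primrec equivProd :=
  Primrec.of_equiv

variable {α : Type*} [Primcodable α] {D : α → Description}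

theorem primrec_labels (hD : Primrec D) : Primrec fun a => (D a).labels :=
  (primrec_equivProd.comp hD).fst_of

theorem primrec_init (hD : Primrec D) : Primrec fun a => (D a).init :=
  (primrec_equivProd.comp hD).snd_of.fst_of

theorem primrec_final (hD : Primrec D) : Primrec fun a => (D a).final :=
  (primrec_equivProd.comp hD).snd_of.snd_of.fst_of

theorem primrec_le (hD : Primrec D) : Primrec fun a => (D a).le :=
  (primrec_equivProd.comp hD).snd_of.snd_of.snd_of.fst_of

theorem primrec_step (hD : Primrec D) : Primrec fun a => (D a).step :=
  (primrec_equivProd.comp hD).snd_of.snd_of.snd_of.snd_of.fst_of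

theorem primrec_pred (hD : Primrec D) : Primrec fun a => (D a).pred :=
  (primrec_equivProd.comp hD).snd_of.snd_of.snd_of.snd_of.snd_of.fst_of

theorem primrec_accel (hD : Primrec D) : Primrec fun a => (D a).accel :=
  (primrec_equivProd.comp hD).snd_of.snd_of.snd_of.snd_of.snd_of.snd_of

theorem semiDecidable_le (hD : Primrec D) {m n : α → ℕ} (hm : Primrec m) (hn : Primrec n) :
    SemiDecidable fun x => (D x).Le (m x) (n x) :=
  .computes (primrec_le hD) (hm.pair hn) (Primrec.const true)

theorem semiDecidable_step (hD : Primrec D) {a m n : α → ℕ} (ha : Primrec a) (hm : Primrec m)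
    (hn : Primrec n) : SemiDecidable fun x => (D x).Step (a x) (m x) (n x) :=
  (SemiDecidable.lt ha (primrec_labels hD)).and
    (.computes (primrec_step hD) (ha.pair (hm.pair hn)) (Primrec.const true))

theorem semiDecidable_run (hD : Primrec D) {w : α → List ℕ} {m n : α → ℕ} (hw : Primrec w)
    (hm : Primrec m) (hn : Primrec n) : SemiDecidable fun x => (D x).Run (w x) (m x) (n x) := by
  have hstep : SemiDecidable fun z : Description × (List ℕ × ℕ) × (List ℕ × ℕ) =>
      z.1.ConfigStep z.2.1 z.2.2 := by
    refine SemiDecidable.ex (p := fun y : (Description × (List ℕ × ℕ) × (List ℕ × ℕ)) × ℕ =>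
      y.1.2.1.1 = y.2 :: y.1.2.2.1 ∧ y.1.1.Step y.2 y.1.2.1.2 y.1.2.2.2) ?_
    have hz : Primrec fun y : (Description × (List ℕ × ℕ) × (List ℕ × ℕ)) × ℕ => y.1 := .fst
    exact (SemiDecidable.eq hz.snd_of.fst_of.fst_of
      (Primrec.list_cons.comp .snd hz.snd_of.snd_of.fst_of)).and
      (semiDecidable_step hz.fst_of .snd hz.snd_of.fst_of.snd_of hz.snd_of.snd_of.snd_of)
  exact hstep.reflTransGen.comp (hD.pair ((hw.pair hm).pair ((Primrec.const []).pair hn)))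

theorem semiDecidable_accelReach (hD : Primrec D) {m n : α → ℕ} (hm : Primrec m)
    (hn : Primrec n) :
    SemiDecidable fun x => Relation.ReflTransGen (D x).AccelStep (m x) (n x) := by
  have hstep : SemiDecidable fun z : Description × ℕ × ℕ => z.1.AccelStep z.2.1 z.2.2 := by
    refine SemiDecidable.or
      (SemiDecidable.ex (p := fun y : (Description × ℕ × ℕ) × ℕ =>
        y.1.1.Step y.2 y.1.2.1 y.1.2.2) ?_)
      (SemiDecidable.ex (p := fun y : (Description × ℕ × ℕ) × (List ℕ × ℕ) =>
        y.2.1 ≠ [] ∧ y.1.1.Run y.2.1 y.1.2.1 y.2.2 ∧ y.1.1.Le y.1.2.1 y.2.2 ∧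
          Computes y.1.1.accel (y.2.1, y.1.2.1) y.1.2.2) ?_)
    · have hz : Primrec fun y : (Description × ℕ × ℕ) × ℕ => y.1 := .fst
      exact semiDecidable_step hz.fst_of .snd hz.snd_of.fst_of hz.snd_of.snd_of
    · have hz : Primrec fun y : (Description × ℕ × ℕ) × (List ℕ × ℕ) => y.1 := .fst
      have hc : Primrec fun y : (Description × ℕ × ℕ) × (List ℕ × ℕ) => y.2 := .snd
      exact (SemiDecidable.ne hc.fst_of (.const [])).and
        ((semiDecidable_run hz.fst_of hc.fst_of hz.snd_of.fst_of hc.snd_of).and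
        ((semiDecidable_le hz.fst_of hz.snd_of.fst_of hc.snd_of).and
        (.computes (primrec_accel hz.fst_of) (hc.fst_of.pair hz.snd_of.fst_of)
          hz.snd_of.snd_of)))
  exact hstep.reflTransGen.comp (hD.pair (hm.pair hn))

theorem semiDecidable_hasIncreasingFork : SemiDecidable HasIncreasingFork := by
  have h : SemiDecidable fun d : Description =>
      ∃ t : (ℕ × ℕ × ℕ × ℕ) × (ℕ × ℕ × ℕ × ℕ) × List ℕ × List ℕ,
        Relation.ReflTransGen d.AccelStep d.init t.1.1 ∧ t.1.2.1 ≠ t.1.2.2.1 ∧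
        d.Step t.1.2.1 t.1.1 t.1.2.2.2 ∧ d.Run t.2.2.1 t.1.2.2.2 t.2.1.1 ∧
        d.Le t.1.1 t.2.1.1 ∧
        d.Step t.1.2.2.1 t.1.1 t.2.1.2.1 ∧
        Relation.ReflTransGen d.AccelStep t.2.1.2.1 t.2.1.2.2.1 ∧ d.Le t.1.1 t.2.1.2.2.1 ∧
        d.Run t.2.2.2 t.1.1 t.2.1.2.2.2 ∧ ∃ g ∈ d.final, d.Le g t.2.1.2.2.2 := by
    let T := Description × (ℕ × ℕ × ℕ × ℕ) × (ℕ × ℕ × ℕ × ℕ) × List ℕ × List ℕ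
    refine SemiDecidable.ex (p := fun y : T =>
        Relation.ReflTransGen y.1.AccelStep y.1.init y.2.1.1 ∧ y.2.1.2.1 ≠ y.2.1.2.2.1 ∧
        y.1.Step y.2.1.2.1 y.2.1.1 y.2.1.2.2.2 ∧ y.1.Run y.2.2.2.1 y.2.1.2.2.2 y.2.2.1.1 ∧
        y.1.Le y.2.1.1 y.2.2.1.1 ∧
        y.1.Step y.2.1.2.2.1 y.2.1.1 y.2.2.1.2.1 ∧
        Relation.ReflTransGen y.1.AccelStep y.2.2.1.2.1 y.2.2.1.2.2.1 ∧
        y.1.Le y.2.1.1 y.2.2.1.2.2.1 ∧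
        y.1.Run y.2.2.2.2 y.2.1.1 y.2.2.1.2.2.2 ∧
        ∃ g ∈ y.1.final, y.1.Le g y.2.2.1.2.2.2) ?_
    have hd : Primrec fun y : T => y.1 := .fst
    have h1 : Primrec fun y : T => y.2.1 := Primrec.snd.fst_of
    have h2 : Primrec fun y : T => y.2.2.1 := Primrec.snd.snd_of.fst_of
    have h3 : Primrec fun y : T => y.2.2.2 := Primrec.snd.snd_of.snd_of
    have hs := h1.fst_of
    have ha := h1.snd_of.fst_of
    have hb := h1.snd_of.snd_of.fst_of
    have hx := h1.snd_of.snd_of.snd_of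
    have hx' := h2.fst_of
    have hy := h2.snd_of.fst_of
    have hy' := h2.snd_of.snd_of.fst_of
    have hf := h2.snd_of.snd_of.snd_of
    have hle : SemiDecidable fun y : T => ∃ g ∈ y.1.final, y.1.Le g y.2.2.1.2.2.2 :=
      SemiDecidable.exists_mem (p := fun z : T × ℕ => z.1.1.Le z.2 z.1.2.2.1.2.2.2)
        (semiDecidable_le (hd.comp .fst) .snd (hf.comp .fst)) (primrec_final hd)
    exact (semiDecidable_accelReach hd (primrec_init hd) hs).and <|
      (SemiDecidable.ne ha hb).and <| (semiDecidable_step hd ha hs hx).and <|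
      (semiDecidable_run hd h3.fst_of hx hx').and <| (semiDecidable_le hd hs hx').and <|
      (semiDecidable_step hd hb hs hy).and <| (semiDecidable_accelReach hd hy hy').and <|
      (semiDecidable_le hd hs hy').and <| (semiDecidable_run hd h3.snd_of hs hf).and hle
  refine h.of_eq fun d => ⟨?_, ?_⟩
  · rintro ⟨⟨⟨s, a, b, x⟩, ⟨x', y, y', f⟩, w, z⟩, ht⟩
    exact ⟨s, a, b, x, x', y, y', f, w, z, ht⟩
  · rintro ⟨s, a, b, x, x', y, y', f, w, z, ht⟩
    exact ⟨⟨⟨s, a, b, x⟩, ⟨x', y, y', f⟩, w, z⟩, ht⟩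

end Description

theorem semiDecidable_residualStep {α : Type*} [Primcodable α] {a : α → ℕ}
    {p q : α → List ℕ × List (List ℕ)} (ha : Primrec a) (hp : Primrec p) (hq : Primrec q) :
    SemiDecidable fun x => ResidualStep (a x) (p x) (q x) := by
  have hcons : Primrec fun x => a x :: (q x).1 := Primrec.list_cons.comp ha hq.fst_of
  have hdrop : SemiDecidable fun x => ∃ i : ℕ,
      (p x).2.drop i = (q x).2 ∧ (q x).2.head? = some (a x :: (q x).1) := by
    refine SemiDecidable.ex (p := fun y : α × ℕ =>
      (p y.1).2.drop y.2 = (q y.1).2 ∧ (q y.1).2.head? = some (a y.1 :: (q y.1).1)) ?_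
    exact (SemiDecidable.eq (Primrec.list_drop.comp .snd (hp.comp .fst).snd_of)
      (hq.comp .fst).snd_of).and (SemiDecidable.eq
        (Primrec.list_head?.comp (hq.comp .fst).snd_of)
        (Primrec.option_some.comp (hcons.comp .fst)))
  exact (SemiDecidable.eq hp (hcons.pair hq.snd_of)).or
    ((SemiDecidable.eq hp.fst_of (.const [])).and hdrop)

namespace Description

/-- Candidates for inclusion certificates. -/
abbrev InclusionCertificate : Type :=
  List (List (List ℕ × List (List ℕ))) × List (List (List ℕ × List (List ℕ)) × ℕ)

section InclusionCertificate

variable {α : Type*} [Primcodable α] {D : α → Description} {C : α → InclusionCertificate}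
  {X X' : α → List (List ℕ × List (List ℕ))}

theorem semiDecidable_exists_le (hD : Primrec D) (hC : Primrec C) (hX : Primrec X) {n : α → ℕ}
    (hn : Primrec n) :
    SemiDecidable fun x => ∃ e ∈ (C x).2, e.1 = X x ∧ (D x).Le e.2 (n x) := by
  refine SemiDecidable.exists_mem
    (p := fun y : α × (List (List ℕ × List (List ℕ)) × ℕ) =>
      y.2.1 = X y.1 ∧ (D y.1).Le y.2.2 (n y.1)) ?_ hC.snd_of
  exact (SemiDecidable.eq Primrec.snd.fst_of (hX.comp .fst)).and
    (semiDecidable_le (hD.comp .fst) Primrec.snd.snd_of (hn.comp .fst))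

theorem semiDecidable_forall_pred (hD : Primrec D) (hC : Primrec C) (hX : Primrec X)
    (hX' : Primrec X') {a : α → ℕ} (ha : Primrec a) :
    SemiDecidable fun x => ∀ e ∈ (C x).2, e.1 ≠ X' x ∨
      ∃ B : List ℕ, Computes (D x).pred (a x, e.2) B ∧
        ∀ n ∈ B, ∃ e' ∈ (C x).2, e'.1 = X x ∧ (D x).Le e'.2 n := by
  let E := List (List ℕ × List (List ℕ)) × ℕ
  refine SemiDecidable.forall_mem (p := fun y : α × E =>
    y.2.1 ≠ X' y.1 ∨ ∃ B : List ℕ, Computes (D y.1).pred (a y.1, y.2.2) B ∧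
      ∀ n ∈ B, ∃ e' ∈ (C y.1).2, e'.1 = X y.1 ∧ (D y.1).Le e'.2 n) ?_ hC.snd_of
  refine (SemiDecidable.ne Primrec.snd.fst_of (hX'.comp .fst)).or ?_
  refine SemiDecidable.ex (p := fun y : (α × E) × List ℕ =>
    Computes (D y.1.1).pred (a y.1.1, y.1.2.2) y.2 ∧
      ∀ n ∈ y.2, ∃ e' ∈ (C y.1.1).2, e'.1 = X y.1.1 ∧ (D y.1.1).Le e'.2 n) ?_
  have h : Primrec fun y : (α × E) × List ℕ => y.1.1 := Primrec.fst.fst_of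
  refine (SemiDecidable.computes (primrec_pred (hD.comp h))
    ((ha.comp h).pair Primrec.fst.snd_of.snd_of) .snd).and ?_
  refine SemiDecidable.forall_mem (p := fun y : ((α × E) × List ℕ) × ℕ =>
    ∃ e' ∈ (C y.1.1.1).2, e'.1 = X y.1.1.1 ∧ (D y.1.1.1).Le e'.2 y.2) ?_ .snd
  have h : Primrec fun y : ((α × E) × List ℕ) × ℕ => y.1.1.1 := Primrec.fst.fst_of.fst_of
  exact semiDecidable_exists_le (hD.comp h) (hC.comp h) (hX.comp h) .snd

theorem semiDecidable_forall_residualStep (hX : Primrec X) (hX' : Primrec X') {a : α → ℕ}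
    (ha : Primrec a) :
    SemiDecidable fun x => ∀ r ∈ X' x, ∃ p ∈ X x, ResidualStep (a x) p r := by
  refine SemiDecidable.forall_mem (p := fun y : α × (List ℕ × List (List ℕ)) =>
    ∃ p ∈ X y.1, ResidualStep (a y.1) p y.2) ?_ hX'
  refine SemiDecidable.exists_mem
    (p := fun y : (α × (List ℕ × List (List ℕ))) × (List ℕ × List (List ℕ)) =>
      ResidualStep (a y.1.1) y.2 y.1.2) ?_ (hX.comp .fst)
  exact semiDecidable_residualStep (ha.comp Primrec.fst.fst_of) .snd Primrec.fst.snd_of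

theorem semiDecidable_exists_successor (hD : Primrec D) (hC : Primrec C) (hX : Primrec X) :
    SemiDecidable fun x => ∀ a ∈ List.range (D x).labels, ∃ X' ∈ (C x).1,
      (∀ r ∈ X', ∃ p ∈ X x, ResidualStep a p r) ∧
      ∀ e ∈ (C x).2, e.1 ≠ X' ∨ ∃ B : List ℕ, Computes (D x).pred (a, e.2) B ∧
        ∀ n ∈ B, ∃ e' ∈ (C x).2, e'.1 = X x ∧ (D x).Le e'.2 n := by
  refine SemiDecidable.forall_mem (p := fun y : α × ℕ => ∃ X' ∈ (C y.1).1,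
      (∀ r ∈ X', ∃ p ∈ X y.1, ResidualStep y.2 p r) ∧
      ∀ e ∈ (C y.1).2, e.1 ≠ X' ∨ ∃ B : List ℕ, Computes (D y.1).pred (y.2, e.2) B ∧
        ∀ n ∈ B, ∃ e' ∈ (C y.1).2, e'.1 = X y.1 ∧ (D y.1).Le e'.2 n) ?_
    (Primrec.list_range.comp (primrec_labels hD))
  refine SemiDecidable.exists_mem
    (p := fun y : (α × ℕ) × List (List ℕ × List (List ℕ)) =>
      (∀ r ∈ y.2, ∃ p ∈ X y.1.1, ResidualStep y.1.2 p r) ∧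
      ∀ e ∈ (C y.1.1).2, e.1 ≠ y.2 ∨ ∃ B : List ℕ, Computes (D y.1.1).pred (y.1.2, e.2) B ∧
        ∀ n ∈ B, ∃ e' ∈ (C y.1.1).2, e'.1 = X y.1.1 ∧ (D y.1.1).Le e'.2 n) ?_
    (hC.comp .fst).fst_of
  have h : Primrec fun y : (α × ℕ) × List (List ℕ × List (List ℕ)) => y.1.1 :=
    Primrec.fst.fst_of
  exact (semiDecidable_forall_residualStep (hX.comp h) .snd Primrec.fst.snd_of).and
    (semiDecidable_forall_pred (hD.comp h) (hC.comp h) (hX.comp h) .snd Primrec.fst.snd_of)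

theorem semiDecidable_isInclusionCertificate (hD : Primrec D) (hC : Primrec C)
    {ws : α → List (List ℕ)} (hws : Primrec ws) :
    SemiDecidable fun x => (D x).IsInclusionCertificate (ws x) (C x).1 (C x).2 := by
  have hstart : Primrec fun x => [(([] : List ℕ), ws x)] :=
    Primrec.list_cons.comp ((Primrec.const []).pair hws) (.const [])
  have h1 : SemiDecidable fun x => ∀ w ∈ ws x, ∀ a ∈ w, a < (D x).labels := by
    refine SemiDecidable.forall_mem (p := fun y : α × List ℕ => ∀ a ∈ y.2, a < (D y.1).labels)
      ?_ hws
    exact SemiDecidable.forall_mem (p := fun y : (α × List ℕ) × ℕ => y.2 < (D y.1.1).labels)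
      (SemiDecidable.lt .snd (primrec_labels (hD.comp Primrec.fst.fst_of))) .snd
  have h2 : SemiDecidable fun x => [(([] : List ℕ), ws x)] ∈ (C x).1 := by
    refine (SemiDecidable.exists_mem
      (p := fun y : α × List (List ℕ × List (List ℕ)) => y.2 = [(([] : List ℕ), ws y.1)])
      (SemiDecidable.eq .snd (hstart.comp .fst)) hC.fst_of).of_eq fun x => ?_
    simp
  have h3 : SemiDecidable fun x => ∀ X ∈ (C x).1,
      (∃ p ∈ X, p.1 = []) ∨ ∀ f ∈ (D x).final, ∃ e ∈ (C x).2, e.1 = X ∧ (D x).Le e.2 f := by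
    refine SemiDecidable.forall_mem (p := fun y : α × List (List ℕ × List (List ℕ)) =>
      (∃ p ∈ y.2, p.1 = []) ∨
        ∀ f ∈ (D y.1).final, ∃ e ∈ (C y.1).2, e.1 = y.2 ∧ (D y.1).Le e.2 f) ?_ hC.fst_of
    refine SemiDecidable.or ?_ ?_
    · exact SemiDecidable.exists_mem
        (p := fun y : (α × List (List ℕ × List (List ℕ))) × (List ℕ × List (List ℕ)) =>
          y.2.1 = []) (SemiDecidable.eq Primrec.snd.fst_of (.const [])) .snd
    · refine SemiDecidable.forall_mem
        (p := fun y : (α × List (List ℕ × List (List ℕ))) × ℕ =>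
          ∃ e ∈ (C y.1.1).2, e.1 = y.1.2 ∧ (D y.1.1).Le e.2 y.2) ?_
        (primrec_final (hD.comp .fst))
      exact semiDecidable_exists_le (hD.comp Primrec.fst.fst_of) (hC.comp Primrec.fst.fst_of)
        Primrec.fst.snd_of .snd
  have h4 : SemiDecidable fun x => ∀ X ∈ (C x).1, ∀ a ∈ List.range (D x).labels,
      ∃ X' ∈ (C x).1, (∀ r ∈ X', ∃ p ∈ X, ResidualStep a p r) ∧
      ∀ e ∈ (C x).2, e.1 ≠ X' ∨ ∃ B : List ℕ, Computes (D x).pred (a, e.2) B ∧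
        ∀ n ∈ B, ∃ e' ∈ (C x).2, e'.1 = X ∧ (D x).Le e'.2 n :=
    SemiDecidable.forall_mem (p := fun y : α × List (List ℕ × List (List ℕ)) =>
      ∀ a ∈ List.range (D y.1).labels,
      ∃ X' ∈ (C y.1).1, (∀ r ∈ X', ∃ p ∈ y.2, ResidualStep a p r) ∧
      ∀ e ∈ (C y.1).2, e.1 ≠ X' ∨ ∃ B : List ℕ, Computes (D y.1).pred (a, e.2) B ∧
        ∀ n ∈ B, ∃ e' ∈ (C y.1).2, e'.1 = y.2 ∧ (D y.1).Le e'.2 n)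
      (semiDecidable_exists_successor (hD.comp .fst) (hC.comp .fst) .snd) hC.fst_of
  have h5 : SemiDecidable fun x => ∀ e ∈ (C x).2,
      e.1 ≠ [(([] : List ℕ), ws x)] ∨ Computes (D x).le (e.2, (D x).init) false := by
    refine SemiDecidable.forall_mem
      (p := fun y : α × (List (List ℕ × List (List ℕ)) × ℕ) =>
        y.2.1 ≠ [(([] : List ℕ), ws y.1)] ∨
          Computes (D y.1).le (y.2.2, (D y.1).init) false) ?_ hC.snd_of
    exact (SemiDecidable.ne Primrec.snd.fst_of (hstart.comp .fst)).or
      (.computes (primrec_le (hD.comp .fst))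
        (Primrec.snd.snd_of.pair (primrec_init (hD.comp .fst))) (.const false))
  exact h1.and (h2.and (h3.and (h4.and h5)))

theorem semiDecidable_exists_isInclusionCertificate :
    SemiDecidable fun x : Description × List (List ℕ) =>
      ∃ C : InclusionCertificate, x.1.IsInclusionCertificate x.2 C.1 C.2 :=
  SemiDecidable.ex
    (p := fun y : (Description × List (List ℕ)) × InclusionCertificate =>
      y.1.1.IsInclusionCertificate y.1.2 y.2.1 y.2.2)
    (semiDecidable_isInclusionCertificate Primrec.fst.fst_of .snd Primrec.fst.snd_of)

end InclusionCertificate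

end Description

/-! ### The two algorithms -/

theorem theorem1 :
    (∃ decideBounded : Description →. Bool, Partrec decideBounded ∧
      ∀ (d : Description) (S : Type u) [PartialOrder S] (ν : ℕ → S)
        (W : WSTS S (Fin d.labels)),
        W.IsCompleteDeterministic → Describes d ν W → IsOrderOpen W.final →
          ∃ b ∈ decideBounded d, (b = true ↔ IsBoundedLanguage W.language)) ∧
    (∃ findExpr : Description →. List (List ℕ), Partrec findExpr ∧
      ∀ (d : Description) (S : Type u) [PartialOrder S] (ν : ℕ → S)
        (W : WSTS S (Fin d.labels)),
        W.IsCompleteDeterministic → Describes d ν W → IsBoundedLanguage W.language →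
          ∃ ws : List (List (Fin d.labels)),
            List.map (List.map Fin.val) ws ∈ findExpr d ∧
              W.language ≤ boundedExpr ws) := by
  have hcert := Description.semiDecidable_exists_isInclusionCertificate
  constructor
  · have hyes : SemiDecidable fun d : Description => ∃ ws : List (List ℕ),
        ∃ C : Description.InclusionCertificate, d.IsInclusionCertificate ws C.1 C.2 := hcert.ex
    -- The answer is part of the search: `true` comes with a certificate and `false` with a fork.
    -- Openness of the final set is needed only for the correctness of `false`.
    have hdec : SemiDecidable fun x : Description × Bool =>
        (x.2 = true ∧ ∃ ws : List (List ℕ),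
          ∃ C : Description.InclusionCertificate, x.1.IsInclusionCertificate ws C.1 C.2) ∨
        (x.2 = false ∧ x.1.HasIncreasingFork) :=
      ((SemiDecidable.eq .snd (.const true)).and (hyes.comp .fst)).or
        ((SemiDecidable.eq .snd (.const false)).and
          (Description.semiDecidable_hasIncreasingFork.comp .fst))
    obtain ⟨f, hf, hsound, hdom⟩ := hdec.exists_partrec
    refine ⟨f, hf, fun d S _ ν W hW hd hF => ?_⟩
    have hfdom : (f d).Dom := by
      by_cases hb : IsBoundedLanguage W.language
      · obtain ⟨ws, hws⟩ := hb
        obtain ⟨Q, I, hc⟩ := hd.exists_isInclusionCertificate hws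
        exact hdom d true (.inl ⟨rfl, _, (Q, I), hc⟩)
      · exact hdom d false (.inr ⟨rfl, hd.hasIncreasingFork_code
          (WSTS.hasIncreasingFork_of_not_isBoundedLanguage hW hb)⟩)
    refine ⟨(f d).get hfdom, Part.get_mem hfdom, ?_⟩
    rcases hsound d _ (Part.get_mem hfdom) with ⟨h, ws, C, hc⟩ | ⟨h, hfork⟩
    · obtain ⟨ws', -, hle⟩ := hd.language_le_of_isInclusionCertificate hc
      exact iff_of_true h ⟨ws', hle⟩
    · refine iff_of_false (by simpa using h) ?_
      exact (hd.hasIncreasingFork hW hfork).not_isBoundedLanguage hW hF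
  · obtain ⟨f, hf, hsound, hdom⟩ := hcert.exists_partrec
    refine ⟨f, hf, fun d S _ ν W hW hd ⟨ws, hws⟩ => ?_⟩
    obtain ⟨Q, I, hc⟩ := hd.exists_isInclusionCertificate hws
    have hfdom := hdom d _ ⟨(Q, I), hc⟩
    obtain ⟨C, hc⟩ := hsound d _ (Part.get_mem hfdom)
    obtain ⟨ws', hws', hle⟩ := hd.language_le_of_isInclusionCertificate hc
    exact ⟨ws', hws' ▸ Part.get_mem hfdom, hle⟩
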